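/- **Setting.** Let $\Omega\subset\mathbb R^3$ be a non-empty, bounded, connected open set with Lipschitz boundary, and let $\Gamma_{\rm Dir}\subset\partial\Omega$ be relatively open and such that, for some $c_0>0$, the Korn inequality $c_0\|u\|_{H^1(\Omega)}^2\le\|u\|^2_{L^2(\Gamma_{\rm Dir})}+\|\varepsilon(u)\|^2_{L^2(\Omega)}$ holds for all $u\in H^1(\Omega;\mathbb R^3)$, where $\varepsilon(u)=\frac12(\nabla u+\nabla u^{\top})$. Let $\mathbb R^{3\times3}_{\rm sym}$ and $\mathbb R^{3\times 3}_{\rm dev}$ be the spaces of symmetric and of symmetric trace-free $3\times3$ tensors, with $a:b=\sum_{i,j}a_{ij}b_{ij}$ and $|a|^2=a:a$. Let * $\mathbb C:\mathbb R^{3\times3}_{\rm sym}\to\mathbb R^{3\times3}_{\rm sym}$ be linear, symmetric and positive definite; $c_1,c_2,c_3>0$; * $\varphi\in C^{2,1}(\mathbb R)$ with $\varphi'$ bounded, $\varphi''\ge0$, and $\varphi(r)=0$ if and only if $r\le c_3$; * $D:\mathbb R^{3\times3}_{\rm dev}\to[0,\infty)$ be lower semicontinuous, positively $1$-homogeneous,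 with $D(a+b)\le D(a)+D(b)$ and $D(a)\ge c_D|a|$ for some $c_D>0$. For $a\in\mathbb R^{3\times3}_{\rm dev}$ put $$F_0(a)=\begin{cases}c_1|a|+c_2|a|^2,&|a|\le c_3,\\+\infty,&|a|>c_3,\end{cases}\qquad F_\rho(a)=c_1\big(\sqrt{\rho^2+|a|^2}-\rho\big)+c_2|a|^2+\tfrac1\rho\varphi(|a|)\quad(\rho>0).$$ For $\nu\ge0$ let $j(0)=0$ and $j(\nu)=1$ if $\nu>0$; let $\mathcal Z^\nu=H^{j(\nu)}(\Omega;\mathbb R^{3\times3}_{\rm dev})$ (with $H^0=L^2$), $\mathcal U=H^1(\Omega;\mathbb R^3)$ and $\mathcal Y^\nu=\mathcal U\times\mathcal Z^\nu$. Given $u^{\rm Dir}\in\mathcal U$, $\ell\in\mathcal U'$ and $\bar z\in L^2(\Omega;\mathbb R^{3\times3}_{\rm dev})$, the incremental functional is, for $\rho,\nu\ge0$ and $(u,z)\in\mathcal Y^\nu$, $$\mathcal I_{\rho,\nu}(u,z)=\frac12\int_\Omega\mathbb C(\varepsilon(u)-z):(\varepsilon(u)-z)\,dx+\int_\Omega\Big(F_\rho(z)+\frac\nu2|\nabla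 z|^2\Big)dx-\langle\ell,u\rangle+\int_\Omega D(z-\bar z)\,dx\in(-\infty,+\infty].$$ **Space approximation.** For $h>0$ let $\mathcal U_h\subset\mathcal U$ and $\mathcal Z_h\subset H^1(\Omega;\mathbb R^{3\times3}_{\rm dev})$ be linear subspaces, $\mathcal U_h$ closed in $H^1$ and $\mathcal Z_h$ closed in $L^2$, which increase as $h$ decreases and are such that $\bigcup_{h>0}(\mathcal U_h\times\mathcal Z_h)$ is dense in $\mathcal Y^\nu$ for every $\nu\ge 0$. Assume there are maps $q_h:\mathcal U\to\mathcal U_h$ and $r^\nu_h:\mathcal Z^\nu\to\mathcal Z_h$ ($h>0$, $\nu\ge0$) such that, as $h\to0$, $q_h(u)\to u$ in $\mathcal U$ for all $u\in\mathcal U$ and, for each fixed $\nu\ge0$, $r_h^\nu(z)\to z$ in $\mathcal Z^\nu$ for all $z\in\mathcal Z^\nu$; $q_h(u)$ vanishes on $\Gamma_{\rm Dir}$ whenever $u$ does; and $|r_h^\nu(z)|\le c_3$ a.e. in $\Omega$ whenever $z\in\mathcal Z^\nu$ and $|z|\le c_3$ a.e. in $\Omega$. For $\rho,\nu\ge 0$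 and $h\ge0$, a minimizer for the parameters $(\rho,\nu,h)$ is a minimizer of $\mathcal I_{\rho,\nu}$ over the set of all $(u,z)\in\mathcal Y^\nu$ with $u=u^{\rm Dir}$ on $\Gamma_{\rm Dir}$ (in the sense of traces) and, if $h>0$, also $u-u^{\rm Dir}\in\mathcal U_h$ and $z\in\mathcal Z_h$. **Theorem (Convergence for the minimum problem).** For all $\rho,\nu,h\ge0$ there is exactly one minimizer $(u,z)_{\rho,\nu,h}$ for the parameters $(\rho,\nu,h)$. Moreover, let $\rho_k,\nu_k,h_k\ge0$ be sequences with $\rho_k\to\rho$, $\nu_k\to\nu$, $h_k\to h$, each of the three sequences being either constant or convergent to $0$. Then $$(u,z)_{\rho_k,\nu_k,h_k}\rightharpoonup(u,z)_{\rho,\nu,h}\qquad\text{weakly in }\mathcal Y^\nu .$$ -/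

import Mathlib

open MeasureTheory Filter Topology
open scoped NNReal ENNReal ContDiff

namespace ShapeMemory

noncomputable section

/-! ### Tensors -/

/-- Three-dimensional Euclidean space. -/
abbrev E3 : Type := EuclideanSpace ℝ (Fin 3)

/-- Real `3 × 3` tensors with the scalar product `a : b = ∑ i j, a i j * b i j`. -/
abbrev Tensor : Type := EuclideanSpace ℝ (Fin 3 × Fin 3)

/-- The symmetric tensors. -/
def symTensors : Submodule ℝ Tensor where
  carrier := {a | ∀ i j, a (i, j) = a (j, i)}
  add_mem' := by
    intro a b ha hb i j
    simp [ha i j, hb i j]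
  zero_mem' := by
    intro i j
    simp
  smul_mem' := by
    intro c a ha i j
    simp [ha i j]

/-- The deviatoric tensors: symmetric with zero trace. -/
def devTensors : Submodule ℝ Tensor where
  carrier := {a | (∀ i j, a (i, j) = a (j, i)) ∧ ∑ i, a (i, i) = 0}
  add_mem' := by
    rintro a b ⟨ha, ha'⟩ ⟨hb, hb'⟩
    refine ⟨fun i j => by simp [ha i j, hb i j], ?_⟩
    simp [Finset.sum_add_distrib, ha', hb']
  zero_mem' := by
    refine ⟨fun i j => by simp, by simp⟩
  smul_mem' := by
    rintro c a ⟨ha, ha'⟩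
    refine ⟨fun i j => by simp [ha i j], ?_⟩
    simp [← Finset.mul_sum, ha']

abbrev SymT : Type := symTensors

abbrev DevT : Type := devTensors

theorem devTensors_le_symTensors : devTensors ≤ symTensors := fun _ ha => ha.1

/-- The inclusion of the deviatoric tensors into the symmetric ones. -/
def devToSym : DevT →L[ℝ] SymT :=
  LinearMap.toContinuousLinearMap (Submodule.inclusion devTensors_le_symTensors)

/-! ### The spaces `L²(Ω; V)` and `H¹(Ω; V)` -/

section Sobolev

variable {V : Type*} [NormedAddCommGroup V] [NormedSpace ℝ V]

/-- `L²(Ω; V)`. -/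
abbrev L2 (Ω : Set E3) (V : Type*) [NormedAddCommGroup V] : Type _ :=
  Lp V 2 ((volume : Measure E3).restrict Ω)

/-- Values of the gradient of a `V`-valued field: `G k` is the `k`-th partial derivative. -/
abbrev Grad (V : Type*) : Type _ := PiLp 2 (fun _ : Fin 3 => V)

/-- `G` is the distributional gradient of `u` in the open set `Ω`. -/
def IsWeakGradient (Ω : Set E3) (u : L2 Ω V) (G : L2 Ω (Grad V)) : Prop :=
  ∀ φ : E3 → ℝ, ContDiff ℝ ∞ φ → HasCompactSupport φ → tsupport φ ⊆ Ω → ∀ k : Fin 3,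
    ∫ x in Ω, (fderiv ℝ φ x (EuclideanSpace.single k 1)) • u x = - ∫ x in Ω, φ x • (G x) k

theorem integrable_smul_L2 {W : Type*} [NormedAddCommGroup W] [NormedSpace ℝ W] {Ω : Set E3}
    (u : L2 Ω W) {ψ : E3 → ℝ} (hψ : Continuous ψ) (hc : HasCompactSupport ψ) :
    Integrable (fun x => ψ x • u x) ((volume : Measure E3).restrict Ω) :=
  ((Lp.memLp u).locallyIntegrable one_le_two).integrable_smul_left_of_hasCompactSupport hψ hc

theorem integrable_smul_L2_apply {Ω : Set E3} (G : L2 Ω (Grad V)) {ψ : E3 → ℝ}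
    (hψ : Continuous ψ) (hc : HasCompactSupport ψ) (k : Fin 3) :
    Integrable (fun x => ψ x • (G x) k) ((volume : Measure E3).restrict Ω) :=
  ((PiLp.proj (𝕜 := ℝ) 2 (fun _ : Fin 3 => V) k).integrable_comp
    (integrable_smul_L2 G hψ hc)).congr (Eventually.of_forall fun x => by simp)

theorem continuous_partial {φ : E3 → ℝ} (hφ : ContDiff ℝ ∞ φ) (v : E3) :
    Continuous fun x => fderiv ℝ φ x v :=
  (hφ.continuous_fderiv (by simp)).clm_apply continuous_const

theorem hasCompactSupport_partial {φ : E3 → ℝ} (hc : HasCompactSupport φ) (v : E3) :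
    HasCompactSupport fun x => fderiv ℝ φ x v :=
  hc.fderiv_apply (𝕜 := ℝ) v

/-- `H¹(Ω; V)`, as the space of the pairs `(u, ∇u)` with the norm
`(‖u‖² + ‖∇u‖²)^(1/2)` of `L²(Ω; V) × L²(Ω; V³)`. -/
def H1 (Ω : Set E3) (V : Type*) [NormedAddCommGroup V] [NormedSpace ℝ V] :
    Submodule ℝ (WithLp 2 (L2 Ω V × L2 Ω (Grad V))) where
  carrier := {p | IsWeakGradient Ω p.fst p.snd}
  add_mem' := by
    intro p q hp hq φ hφ hc hs k
    have h1 : ∫ x in Ω, (fderiv ℝ φ x (EuclideanSpace.single k 1)) • (p.fst + q.fst : L2 Ω V) x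
        = (∫ x in Ω, (fderiv ℝ φ x (EuclideanSpace.single k 1)) • p.fst x)
          + ∫ x in Ω, (fderiv ℝ φ x (EuclideanSpace.single k 1)) • q.fst x := by
      rw [← integral_add
        (integrable_smul_L2 p.fst (continuous_partial hφ _) (hasCompactSupport_partial hc _))
        (integrable_smul_L2 q.fst (continuous_partial hφ _) (hasCompactSupport_partial hc _))]
      refine integral_congr_ae ?_
      filter_upwards [Lp.coeFn_add p.fst q.fst] with x hx
      rw [hx, Pi.add_apply, smul_add]
    have h2 : ∫ x in Ω, φ x • ((p.snd + q.snd : L2 Ω (Grad V)) x) k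
        = (∫ x in Ω, φ x • (p.snd x) k) + ∫ x in Ω, φ x • (q.snd x) k := by
      rw [← integral_add (integrable_smul_L2_apply p.snd hφ.continuous hc k)
        (integrable_smul_L2_apply q.snd hφ.continuous hc k)]
      refine integral_congr_ae ?_
      filter_upwards [Lp.coeFn_add p.snd q.snd] with x hx
      rw [hx, Pi.add_apply, PiLp.add_apply, smul_add]
    have e1 : (p + q).fst = p.fst + q.fst := rfl
    have e2 : (p + q).snd = p.snd + q.snd := rfl
    rw [e1, e2, h1, h2, hp φ hφ hc hs k, hq φ hφ hc hs k, neg_add]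
  zero_mem' := by
    intro φ hφ hc hs k
    have h1 : ∫ x in Ω, (fderiv ℝ φ x (EuclideanSpace.single k 1)) • (0 : L2 Ω V) x = 0 := by
      refine integral_eq_zero_of_ae ?_
      filter_upwards [Lp.coeFn_zero V 2 ((volume : Measure E3).restrict Ω)] with x hx
      rw [hx]; simp
    have h2 : ∫ x in Ω, φ x • ((0 : L2 Ω (Grad V)) x) k = 0 := by
      refine integral_eq_zero_of_ae ?_
      filter_upwards [Lp.coeFn_zero (Grad V) 2 ((volume : Measure E3).restrict Ω)] with x hx
      rw [hx]; simp
    have e1 : (0 : WithLp 2 (L2 Ω V × L2 Ω (Grad V))).fst = 0 := rfl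
    have e2 : (0 : WithLp 2 (L2 Ω V × L2 Ω (Grad V))).snd = 0 := rfl
    rw [e1, e2, h1, h2, neg_zero]
  smul_mem' := by
    intro c p hp φ hφ hc hs k
    have h1 : ∫ x in Ω, (fderiv ℝ φ x (EuclideanSpace.single k 1)) • (c • p.fst : L2 Ω V) x
        = c • ∫ x in Ω, (fderiv ℝ φ x (EuclideanSpace.single k 1)) • p.fst x := by
      rw [← integral_smul]
      refine integral_congr_ae ?_
      filter_upwards [Lp.coeFn_smul c p.fst] with x hx
      rw [hx, Pi.smul_apply, smul_comm]
    have h2 : ∫ x in Ω, φ x • ((c • p.snd : L2 Ω (Grad V)) x) k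
        = c • ∫ x in Ω, φ x • (p.snd x) k := by
      rw [← integral_smul]
      refine integral_congr_ae ?_
      filter_upwards [Lp.coeFn_smul c p.snd] with x hx
      rw [hx, Pi.smul_apply, PiLp.smul_apply, smul_comm]
    have e1 : (c • p).fst = c • p.fst := rfl
    have e2 : (c • p).snd = c • p.snd := rfl
    rw [e1, e2, h1, h2, hp φ hφ hc hs k, smul_neg]

/-- The function underlying an element of `H¹(Ω; V)`. -/
def toL2 {Ω : Set E3} (u : H1 Ω V) : L2 Ω V := u.1.fst

/-- The weak gradient of an element of `H¹(Ω; V)`. -/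
def weakGrad {Ω : Set E3} (u : H1 Ω V) : L2 Ω (Grad V) := u.1.snd

/-- The function `z ∈ L²(Ω; V)` belongs to `H¹(Ω; V)`. -/
def IsH1 {Ω : Set E3} (z : L2 Ω V) : Prop := ∃ Z : H1 Ω V, toL2 Z = z

/-- `∫_Ω |∇z|²` for `z ∈ H¹(Ω; V)`, and `+∞` for all other `z ∈ L²(Ω; V)`. (The weak gradient
being unique, the infimum is over at most one element.) -/
def gradEnergy {Ω : Set E3} (z : L2 Ω V) : ℝ≥0∞ :=
  ⨅ (Z : H1 Ω V) (_ : toL2 Z = z), ENNReal.ofReal (‖weakGrad Z‖ ^ 2)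

/-- The space `H^{j(ν)}(Ω; V)`, with `j(0) = 0` and `j(ν) = 1` otherwise, inside `L²(Ω; V)`. -/
def MemSobolev {Ω : Set E3} (ν : ℝ) (z : L2 Ω V) : Prop := ν ≠ 0 → IsH1 z

open Classical in
/-- The square of the norm of `H^{j(ν)}(Ω; V)` (infinite outside that space). -/
def sobolevNormSq {Ω : Set E3} (ν : ℝ) (z : L2 Ω V) : ℝ≥0∞ :=
  ENNReal.ofReal (‖z‖ ^ 2) + if ν = 0 then 0 else gradEnergy z

/-- Convergence of a sequence in the weak topology of a normed space. -/
def WeaklyTendsto {X : Type*} [NormedAddCommGroup X] [NormedSpace ℝ X] (x : ℕ → X) (l : X) :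
    Prop :=
  Tendsto (fun k => toWeakSpace ℝ X (x k)) atTop (𝓝 (toWeakSpace ℝ X l))

/-- Weak convergence in `H^{j(ν)}(Ω; V)`: in `L²(Ω; V)` if `ν = 0`; otherwise all functions lie in
`H¹(Ω; V)` and the convergence is weak in `H¹(Ω; V)`. -/
def WeaklyTendstoSobolev {Ω : Set E3} (ν : ℝ) (z : ℕ → L2 Ω V) (l : L2 Ω V) : Prop :=
  (ν = 0 ∧ WeaklyTendsto z l) ∨
  (ν ≠ 0 ∧ ∃ (Z : ℕ → H1 Ω V) (L : H1 Ω V),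
    (∀ k, toL2 (Z k) = z k) ∧ toL2 L = l ∧ WeaklyTendsto Z L)

end Sobolev

/-! ### Domain, boundary values, strain -/

/-- `Ω` has a Lipschitz boundary: near each boundary point and in suitable Cartesian coordinates,
`Ω` is the region strictly below the graph of a Lipschitz function. -/
def HasLipschitzBoundary (Ω : Set E3) : Prop :=
  ∀ x ∈ frontier Ω, ∃ (r : ℝ) (A : E3 ≃ₗᵢ[ℝ] E3) (K : ℝ≥0) (g : EuclideanSpace ℝ (Fin 2) → ℝ),
    0 < r ∧ LipschitzWith K g ∧
      ∀ y ∈ Metric.ball x r, (y ∈ Ω ↔ (A y) 2 < g !₂[(A y) 0, (A y) 1])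

/-- The classical gradient of a vector field; component `k` is the derivative in direction `k`. -/
def classicalGrad (φ : E3 → E3) (x : E3) : Grad E3 :=
  WithLp.toLp 2 fun k => fderiv ℝ φ x (EuclideanSpace.single k 1)

/-- `g` is the trace of `u ∈ H¹(Ω; ℝ³)` on the part `Γ` of the boundary: `(u, g)` is the limit, in
`H¹(Ω; ℝ³) × L²(Γ; ℝ³)`, of the restrictions of smooth fields on `ℝ³`. -/
def HasTrace (Ω Γ : Set E3) (u : H1 Ω E3)
    (g : Lp E3 2 ((Measure.hausdorffMeasure 2 : Measure E3).restrict Γ)) : Prop :=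
  ∃ φ : ℕ → E3 → E3, (∀ n, ContDiff ℝ ∞ (φ n)) ∧
    Tendsto (fun n => eLpNorm (fun x => φ n x - toL2 u x) 2 (volume.restrict Ω)) atTop (𝓝 0) ∧
    Tendsto (fun n => eLpNorm (fun x => classicalGrad (φ n) x - weakGrad u x) 2 (volume.restrict Ω))
      atTop (𝓝 0) ∧
    Tendsto (fun n => eLpNorm (fun x => φ n x - g x) 2
      ((Measure.hausdorffMeasure 2 : Measure E3).restrict Γ)) atTop (𝓝 0)

/-- `u = 0` on `Γ` in the sense of traces. -/
def VanishesOn (Ω Γ : Set E3) (u : H1 Ω E3) : Prop := HasTrace Ω Γ u 0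

/-- The symmetric part of a displacement gradient. -/
def symPartFun (G : Grad E3) : SymT :=
  ⟨WithLp.toLp 2 fun p => (G p.1 p.2 + G p.2 p.1) / 2, fun i j => by
    change (G i j + G j i) / 2 = (G j i + G i j) / 2
    rw [add_comm]⟩

theorem symPartFun_add (G H : Grad E3) : symPartFun (G + H) = symPartFun G + symPartFun H := by
  apply Subtype.ext
  ext p
  change ((G p.1 p.2 + H p.1 p.2) + (G p.2 p.1 + H p.2 p.1)) / 2
    = (G p.1 p.2 + G p.2 p.1) / 2 + (H p.1 p.2 + H p.2 p.1) / 2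
  ring

theorem symPartFun_smul (c : ℝ) (G : Grad E3) : symPartFun (c • G) = c • symPartFun G := by
  apply Subtype.ext
  ext p
  change (c * G p.1 p.2 + c * G p.2 p.1) / 2 = c * ((G p.1 p.2 + G p.2 p.1) / 2)
  ring

theorem continuous_symPartFun : Continuous symPartFun := by
  refine Continuous.subtype_mk ?_ _
  refine (PiLp.continuous_toLp 2 _).comp (continuous_pi fun p => ?_)
  fun_prop

/-- The symmetric part of a displacement gradient, as a continuous linear map. -/
def symPart : Grad E3 →L[ℝ] SymT where
  toFun := symPartFun
  map_add' := symPartFun_add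
  map_smul' := symPartFun_smul
  cont := continuous_symPartFun

/-- The linearized strain `ε(u) = (∇u + ∇uᵀ) / 2`. -/
def strain {Ω : Set E3} (u : H1 Ω E3) : L2 Ω SymT := symPart.compLp (weakGrad u)

/-- The Korn inequality
`c₀ ‖u‖²_{H¹(Ω)} ≤ ‖u‖²_{L²(Γ)} + ‖ε(u)‖²_{L²(Ω)}` for all `u ∈ H¹(Ω; ℝ³)`. -/
def KornInequality (Ω Γ : Set E3) : Prop :=
  ∃ c₀ : ℝ, 0 < c₀ ∧ ∀ (u : H1 Ω E3)
    (g : Lp E3 2 ((Measure.hausdorffMeasure 2 : Measure E3).restrict Γ)), HasTrace Ω Γ u g →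
      c₀ * ‖u‖ ^ 2 ≤ ‖g‖ ^ 2 + ‖strain u‖ ^ 2

/-! ### Material and energies -/

/-- The constitutive data: elasticity tensor `C`, constants `c₁, c₂, c₃`, the function `φ` of the
regularization of the inelastic energy density, and the dissipation potential `D`. -/
structure Material where
  C : SymT →ₗ[ℝ] SymT
  C_symm : C.IsSymmetric
  C_pos : ∀ a : SymT, a ≠ 0 → 0 < inner ℝ (C a) a
  c₁ : ℝ
  c₂ : ℝ
  c₃ : ℝ
  c₁_pos : 0 < c₁
  c₂_pos : 0 < c₂
  c₃_pos : 0 < c₃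
  φ : ℝ → ℝ
  φ_contDiff : ContDiff ℝ 2 φ
  φ_lipschitz : ∃ K : ℝ≥0, LipschitzWith K (deriv (deriv φ))
  φ_deriv_bdd : ∃ M : ℝ, ∀ r, |deriv φ r| ≤ M
  φ_convex : ∀ r, 0 ≤ deriv (deriv φ) r
  φ_eq_zero_iff : ∀ r, φ r = 0 ↔ r ≤ c₃
  D : DevT → ℝ
  D_lsc : LowerSemicontinuous D
  D_homogeneous : ∀ (s : ℝ) (a : DevT), 0 ≤ s → D (s • a) = s * D a
  D_triangle : ∀ a b : DevT, D (a + b) ≤ D a + D b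
  D_coercive : ∃ cD : ℝ, 0 < cD ∧ ∀ a : DevT, cD * ‖a‖ ≤ D a

namespace Material

variable (M : Material)

open Classical in
/-- The inelastic energy density: for `ρ = 0` it is `c₁|a| + c₂|a|²` on the ball `|a| ≤ c₃` and
`+∞` outside, for `ρ > 0` it is `c₁(√(ρ² + |a|²) - ρ) + c₂|a|² + φ(|a|)/ρ`. -/
def F (ρ : ℝ) (a : DevT) : ℝ≥0∞ :=
  if ρ = 0 then
    if ‖a‖ ≤ M.c₃ then ENNReal.ofReal (M.c₁ * ‖a‖ + M.c₂ * ‖a‖ ^ 2) else ⊤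
  else
    ENNReal.ofReal (M.c₁ * (√(ρ ^ 2 + ‖a‖ ^ 2) - ρ) + M.c₂ * ‖a‖ ^ 2 + M.φ ‖a‖ / ρ)

variable {Ω : Set E3}

/-- The elastic energy `½ ∫_Ω C(a) : a`. -/
def elasticEnergy (a : L2 Ω SymT) : ℝ :=
  (1 / 2) * ∫ x in Ω, inner ℝ (M.C (a x)) (a x)

/-- The inelastic energy `∫_Ω (F_ρ(z) + ν/2 |∇z|²)`. For `ν = 0` the second term vanishes on all of
`L²(Ω)` (in `ℝ≥0∞` one has `0 * ⊤ = 0`); for `ν > 0` it is `+∞` outside `H¹(Ω)`. -/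
def inelasticEnergy (ρ ν : ℝ) (z : L2 Ω DevT) : ℝ≥0∞ :=
  (∫⁻ x in Ω, M.F ρ (z x)) + ENNReal.ofReal (ν / 2) * gradEnergy z

/-- The stored energy `W_{ρ,ν}(u, z)`. -/
def storedEnergy (ρ ν : ℝ) (u : H1 Ω E3) (z : L2 Ω DevT) : ℝ≥0∞ :=
  ENNReal.ofReal (M.elasticEnergy (strain u - devToSym.compLp z)) + M.inelasticEnergy ρ ν z

/-- The dissipation `∫_Ω D(a)`. -/
def dissipation (a : L2 Ω DevT) : ℝ := ∫ x in Ω, M.D (a x)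

/-- The incremental functional `I_{ρ,ν}(u, z) = W_{ρ,ν}(u, z) - ⟨ℓ, u⟩ + ∫_Ω D(z - z̄)`. -/
def incremental (ℓ : H1 Ω E3 →L[ℝ] ℝ) (zbar : L2 Ω DevT) (ρ ν : ℝ)
    (y : H1 Ω E3 × L2 Ω DevT) : EReal :=
  (M.storedEnergy ρ ν y.1 y.2 : EReal) + ((- ℓ y.1 + M.dissipation (y.2 - zbar) : ℝ) : EReal)

end Material

/-! ### Space approximation -/

/-- Approximating spaces `U_h × Z_h`, `h > 0`, together with the operators
`q_h : H¹(Ω; ℝ³) → U_h` and `r_h^ν : H^{j(ν)}(Ω; dev) → Z_h`. -/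
structure SpaceApprox (Ω Γ : Set E3) (c₃ : ℝ) where
  U : ℝ → Submodule ℝ (H1 Ω E3)
  Z : ℝ → Submodule ℝ (L2 Ω DevT)
  isClosed_U : ∀ h, 0 < h → IsClosed (U h : Set (H1 Ω E3))
  isClosed_Z : ∀ h, 0 < h → IsClosed (Z h : Set (L2 Ω DevT))
  isH1_of_mem_Z : ∀ h, 0 < h → ∀ z ∈ Z h, IsH1 z
  mono_U : ∀ h h', 0 < h → h ≤ h' → U h' ≤ U h
  mono_Z : ∀ h h', 0 < h → h ≤ h' → Z h' ≤ Z h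
  dense : ∀ ν, 0 ≤ ν → ∀ (u : H1 Ω E3) (z : L2 Ω DevT), MemSobolev ν z → ∀ δ : ℝ, 0 < δ →
    ∃ h, 0 < h ∧ ∃ v ∈ U h, ∃ w ∈ Z h, ‖v - u‖ < δ ∧ sobolevNormSq ν (w - z) < ENNReal.ofReal δ
  q : ℝ → H1 Ω E3 → H1 Ω E3
  q_mem : ∀ h, 0 < h → ∀ u, q h u ∈ U h
  q_tendsto : ∀ u, Tendsto (fun h => q h u) (𝓝[>] 0) (𝓝 u)
  q_vanishesOn : ∀ h, 0 < h → ∀ u, VanishesOn Ω Γ u → VanishesOn Ω Γ (q h u)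
  r : ℝ → ℝ → L2 Ω DevT → L2 Ω DevT
  r_mem : ∀ ν h, 0 ≤ ν → 0 < h → ∀ z, MemSobolev ν z → r ν h z ∈ Z h
  r_tendsto : ∀ ν, 0 ≤ ν → ∀ z, MemSobolev ν z →
    Tendsto (fun h => sobolevNormSq ν (r ν h z - z)) (𝓝[>] 0) (𝓝 0)
  r_bound : ∀ ν h, 0 ≤ ν → 0 < h → ∀ z, MemSobolev ν z →
    (∀ᵐ x ∂((volume : Measure E3).restrict Ω), ‖z x‖ ≤ c₃) →
    ∀ᵐ x ∂((volume : Measure E3).restrict Ω), ‖r ν h z x‖ ≤ c₃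

/-- The admissible states: `(u, z) ∈ H¹ × H^{j(ν)}` with `u = uDir` on `Γ` and, if `h > 0`, with
`(u - uDir, z) ∈ U_h × Z_h`. The value `h = 0` means that there is no space discretization. -/
def admissible {Ω Γ : Set E3} {c₃ : ℝ} (A : SpaceApprox Ω Γ c₃) (uDir : H1 Ω E3) (ν h : ℝ) :
    Set (H1 Ω E3 × L2 Ω DevT) :=
  {y | MemSobolev ν y.2 ∧ VanishesOn Ω Γ (y.1 - uDir) ∧
    (h ≠ 0 → y.1 - uDir ∈ A.U h ∧ y.2 ∈ A.Z h)}

/-- `y = (u, z)` minimizes the incremental functional among the admissible states. -/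
def IsMinimizer {Ω Γ : Set E3} (M : Material) (A : SpaceApprox Ω Γ M.c₃) (uDir : H1 Ω E3)
    (ℓ : H1 Ω E3 →L[ℝ] ℝ) (zbar : L2 Ω DevT) (ρ ν h : ℝ) (y : H1 Ω E3 × L2 Ω DevT) : Prop :=
  y ∈ admissible A uDir ν h ∧
    ∀ y' ∈ admissible A uDir ν h, M.incremental ℓ zbar ρ ν y ≤ M.incremental ℓ zbar ρ ν y'

/-- Weak convergence in `Y^ν = H¹(Ω; ℝ³) × H^{j(ν)}(Ω; dev)`. -/
def WeaklyTendstoState {Ω : Set E3} (ν : ℝ) (y : ℕ → H1 Ω E3 × L2 Ω DevT)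
    (l : H1 Ω E3 × L2 Ω DevT) : Prop :=
  WeaklyTendsto (fun k => (y k).1) l.1 ∧ WeaklyTendstoSobolev ν (fun k => (y k).2) l.2

/-- The parameters `a k ≥ 0` converge to `b ≥ 0`, either being constant or converging to `0`. -/
def ConstOrToZero (a : ℕ → ℝ) (b : ℝ) : Prop :=
  (∀ k, 0 ≤ a k) ∧ 0 ≤ b ∧ ((∀ k, a k = b) ∨ (b = 0 ∧ Tendsto a atTop (𝓝 0)))

end

end ShapeMemory

open ShapeMemory

/-!
The minimizers converge strongly, and neither weak compactness nor lower semicontinuity in a weak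
topology is needed, because the energies are strongly convex uniformly in all parameters.

On the admissible states of finite energy the incremental functional is a real-valued function
`Material.energy` (`isMinimizer_iff`). Its elastic part is a positive definite quadratic form in
`ε(u) - z`, the density `F_ρ` contains `c₂|z|²`, the gradient term is a square, and the remaining
terms are convex. By Korn's inequality the midpoint of two admissible states `y`, `w` has an energy below the
mean of the two energies by at least `β ‖y - w‖²`, with `β` independent of `ρ`, `ν` and `h`
(`Material.exists_energy_midpoint`); here the norm is that of `H¹ × H^{j(ν)}`, with weight `ν` on
the gradient of `z`. The energy is continuous for this norm and bounded below.

*Existence and uniqueness.* For `ρ > 0` a minimizing sequence is a Cauchy sequence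
(`cauchy_of_midpoint`), and the admissible set is complete. The densities `F_ρ` increase to `F_0` as
`ρ` decreases to `0`, so the minimal energies for `ρ = 1 / (n + 1)` increase and are bounded by the
infimum for `ρ = 0`. Hence they converge, so that by the same midpoint argument the minimizers are
a Cauchy sequence; the limit satisfies `|z| ≤ c₃` and is a minimizer for `ρ = 0`
(`exists_min_limit`). In particular the minimal energies are continuous at `ρ = 0`.

*Convergence.* The admissible sets are contained in the one for the limit parameters, and the energy
is monotone in `ν` and in `ρ`; with the continuity at `ρ = 0`, the minimal energies are eventually
not much smaller than the limit one (`eventually_energy_ge`). Conversely, the interpolation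
operators turn the limit minimizer into a nearby state which is fixed and admissible for all late
parameters (`exists_competitor`), and whose energy converges. Strong convexity bounds the distance
of this competitor to the minimizers by the difference of the energies
(`tendstoState_of_isMinimizer`).
-/

namespace ShapeMemory

noncomputable section

/-! ### The constitutive functions -/

/-- A positive definite form on a finite-dimensional space is coercive, by compactness of the unit
sphere. -/
theorem exists_coercive {V : Type*} [NormedAddCommGroup V] [InnerProductSpace ℝ V]
    [FiniteDimensional ℝ V] (C : V →L[ℝ] V) (hC : ∀ a : V, a ≠ 0 → 0 < inner ℝ (C a) a) :
    ∃ κ : ℝ, 0 < κ ∧ ∀ a : V, κ * ‖a‖ ^ 2 ≤ inner ℝ (C a) a := by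
  have hc : Continuous fun a : V => (inner ℝ (C a) a : ℝ) := C.continuous.inner continuous_id
  have hmem : ∀ a : V, a ≠ 0 → ‖a‖⁻¹ • a ∈ Metric.sphere (0 : V) 1 := fun a ha => by
    rw [mem_sphere_zero_iff_norm, norm_smul, norm_inv, norm_norm,
      inv_mul_cancel₀ (norm_ne_zero_iff.2 ha)]
  rcases (Metric.sphere (0 : V) 1).eq_empty_or_nonempty with he | hne
  · refine ⟨1, one_pos, fun a => ?_⟩
    by_cases ha : a = 0
    · simp [ha]
    · exact absurd (hmem a ha) (by simp [he])
  · obtain ⟨e, he, hmin⟩ := (isCompact_sphere (0 : V) 1).exists_isMinOn hne hc.continuousOn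
    have he0 : e ≠ 0 := fun h => by simp [h] at he
    refine ⟨inner ℝ (C e) e, hC e he0, fun a => ?_⟩
    by_cases ha : a = 0
    · simp [ha]
    · have hna := norm_ne_zero_iff.2 ha
      have h1 : (inner ℝ (C e) e : ℝ) ≤ inner ℝ (C (‖a‖⁻¹ • a)) (‖a‖⁻¹ • a) := hmin (hmem a ha)
      rw [map_smul, real_inner_smul_left, real_inner_smul_right] at h1
      have h2 : ‖a‖⁻¹ * (‖a‖⁻¹ * (inner ℝ (C a) a : ℝ)) * ‖a‖ ^ 2 = inner ℝ (C a) a := by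
        field_simp
      rw [← h2]
      exact mul_le_mul_of_nonneg_right h1 (by positivity)

namespace Material

variable (M : Material)

theorem differentiable_φ : Differentiable ℝ M.φ :=
  M.φ_contDiff.differentiable (by norm_num)

theorem differentiable_deriv_φ : Differentiable ℝ (deriv M.φ) :=
  M.φ_contDiff.differentiable_deriv_two

theorem φ_eq_zero {r : ℝ} (hr : r ≤ M.c₃) : M.φ r = 0 := (M.φ_eq_zero_iff r).2 hr

theorem convexOn_φ : ConvexOn ℝ Set.univ M.φ :=
  convexOn_univ_of_deriv2_nonneg M.differentiable_φ M.differentiable_deriv_φ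
    fun x => by simpa using M.φ_convex x

theorem φ_midpoint (r s : ℝ) : M.φ ((r + s) / 2) ≤ (M.φ r + M.φ s) / 2 := by
  have h := M.convexOn_φ.2 (Set.mem_univ r) (Set.mem_univ s)
    (by norm_num : (0 : ℝ) ≤ 1 / 2) (by norm_num : (0 : ℝ) ≤ 1 / 2) (by norm_num)
  simp only [smul_eq_mul] at h
  have e : (r + s) / 2 = 1 / 2 * r + 1 / 2 * s := by ring
  rw [e]; linarith

/-- The derivative of `φ` is nondecreasing and vanishes to the left of `c₃`. -/
theorem deriv_φ_nonneg (r : ℝ) : 0 ≤ deriv M.φ r := by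
  have hmono : Monotone (deriv M.φ) :=
    monotone_of_deriv_nonneg M.differentiable_deriv_φ M.φ_convex
  have hzero : ∀ s < M.c₃, deriv M.φ s = 0 := by
    intro s hs
    have : M.φ =ᶠ[𝓝 s] fun _ => 0 := by
      filter_upwards [Iio_mem_nhds hs] with t ht using M.φ_eq_zero ht.le
    rw [this.deriv_eq]; simp
  have h1 : min r (M.c₃ - 1) < M.c₃ := (min_le_right _ _).trans_lt (by linarith)
  rw [← hzero _ h1]
  exact hmono (min_le_left _ _)

theorem monotone_φ : Monotone M.φ :=
  monotone_of_deriv_nonneg M.differentiable_φ M.deriv_φ_nonneg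

theorem φ_nonneg (r : ℝ) : 0 ≤ M.φ r := by
  rw [← M.φ_eq_zero (min_le_right r M.c₃)]
  exact M.monotone_φ (min_le_left _ _)

theorem exists_lipschitzWith_φ : ∃ K : ℝ≥0, LipschitzWith K M.φ := by
  obtain ⟨B, hB⟩ := M.φ_deriv_bdd
  refine ⟨B.toNNReal, lipschitzWith_of_nnnorm_deriv_le M.differentiable_φ fun x => ?_⟩
  rw [← NNReal.coe_le_coe, coe_nnnorm, Real.norm_eq_abs]
  exact (hB x).trans (Real.le_coe_toNNReal B)

/-- The part of the inelastic energy density without the quadratic term, as a function of `|a|`.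
As `x / 0 = 0`, the value at `ρ = 0` is `c₁|a|`, which is the right one on the ball `|a| ≤ c₃`. -/
def G (ρ r : ℝ) : ℝ := M.c₁ * (√(ρ ^ 2 + r ^ 2) - ρ) + M.φ r / ρ

theorem G_zero_right {ρ : ℝ} (hρ : 0 ≤ ρ) : M.G ρ 0 = 0 := by
  simp [G, Real.sqrt_sq hρ, M.φ_eq_zero M.c₃_pos.le]

theorem G_zero_left {r : ℝ} (hr : 0 ≤ r) : M.G 0 r = M.c₁ * r := by
  simp [G, Real.sqrt_sq hr]

theorem le_sqrt_add_sq {ρ r : ℝ} : ρ ≤ √(ρ ^ 2 + r ^ 2) :=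
  Real.le_sqrt_of_sq_le (by nlinarith [sq_nonneg r])

theorem G_nonneg {ρ : ℝ} (hρ : 0 ≤ ρ) (r : ℝ) : 0 ≤ M.G ρ r :=
  add_nonneg (mul_nonneg M.c₁_pos.le (sub_nonneg.2 le_sqrt_add_sq))
    (div_nonneg (M.φ_nonneg r) hρ)

theorem sqrt_add_sq_sub_anti {σ ρ r : ℝ} (hσ : 0 ≤ σ) (h : σ ≤ ρ) :
    √(ρ ^ 2 + r ^ 2) - ρ ≤ √(σ ^ 2 + r ^ 2) - σ := by
  have h1 : √(ρ ^ 2 + r ^ 2) ≤ √(σ ^ 2 + r ^ 2) + (ρ - σ) := by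
    apply Real.sqrt_le_iff.2
    have h2 : σ ≤ √(σ ^ 2 + r ^ 2) := le_sqrt_add_sq
    refine ⟨by linarith, ?_⟩
    have h3 := Real.sq_sqrt (show 0 ≤ σ ^ 2 + r ^ 2 by positivity)
    nlinarith
  linarith

/-- The penalized density increases as `ρ` decreases. -/
theorem G_anti {σ ρ : ℝ} (hσ : 0 < σ) (h : σ ≤ ρ) (r : ℝ) : M.G ρ r ≤ M.G σ r := by
  refine add_le_add (mul_le_mul_of_nonneg_left (sqrt_add_sq_sub_anti hσ.le h) M.c₁_pos.le) ?_
  exact div_le_div_of_nonneg_left (M.φ_nonneg r) hσ h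

theorem G_le_G_zero {ρ r : ℝ} (hρ : 0 ≤ ρ) (hr : r ≤ M.c₃) : M.G ρ r ≤ M.G 0 r := by
  have h := mul_le_mul_of_nonneg_left (sqrt_add_sq_sub_anti (r := r) le_rfl hρ) M.c₁_pos.le
  simpa [G, M.φ_eq_zero hr] using h

/-- The deviation from the density at `ρ = 0` is at most `c₁ρ`, apart from the penalty. -/
theorem G_zero_sub_le {ρ r : ℝ} (hr : 0 ≤ r) :
    M.G 0 r - M.c₁ * ρ + M.φ r / ρ ≤ M.G ρ r := by
  rw [M.G_zero_left hr, G]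
  have h1 : r ≤ √(ρ ^ 2 + r ^ 2) := Real.le_sqrt_of_sq_le (by nlinarith [sq_nonneg ρ])
  nlinarith [mul_le_mul_of_nonneg_left h1 M.c₁_pos.le]

theorem sqrt_add_sq_midpoint (ρ r s : ℝ) :
    √(ρ ^ 2 + ((r + s) / 2) ^ 2) ≤ (√(ρ ^ 2 + r ^ 2) + √(ρ ^ 2 + s ^ 2)) / 2 := by
  apply Real.sqrt_le_iff.2
  refine ⟨by positivity, ?_⟩
  have h1 := Real.sq_sqrt (show 0 ≤ ρ ^ 2 + r ^ 2 by positivity)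
  have h2 := Real.sq_sqrt (show 0 ≤ ρ ^ 2 + s ^ 2 by positivity)
  have h3 : ρ ^ 2 + r * s ≤ √(ρ ^ 2 + r ^ 2) * √(ρ ^ 2 + s ^ 2) := by
    rw [← Real.sqrt_mul (by positivity)]
    apply Real.le_sqrt_of_sq_le
    nlinarith [sq_nonneg (ρ * (r - s))]
  nlinarith

theorem G_mono {ρ r s : ℝ} (hρ : 0 ≤ ρ) (hr : 0 ≤ r) (h : r ≤ s) : M.G ρ r ≤ M.G ρ s := by
  refine add_le_add (mul_le_mul_of_nonneg_left (sub_le_sub_right (Real.sqrt_le_sqrt ?_) _)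
    M.c₁_pos.le) (div_le_div_of_nonneg_right (M.monotone_φ h) hρ)
  nlinarith

theorem G_midpoint {ρ : ℝ} (hρ : 0 ≤ ρ) (r s : ℝ) :
    M.G ρ ((r + s) / 2) ≤ (M.G ρ r + M.G ρ s) / 2 := by
  have h1 := mul_le_mul_of_nonneg_left (sqrt_add_sq_midpoint ρ r s) M.c₁_pos.le
  have h2 := div_le_div_of_nonneg_right (M.φ_midpoint r s) hρ
  have h3 : (M.φ r + M.φ s) / 2 / ρ = (M.φ r / ρ + M.φ s / ρ) / 2 := by ring
  rw [h3] at h2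
  simp only [G]
  linarith

theorem G_norm_midpoint {ρ : ℝ} (hρ : 0 ≤ ρ) (a b : DevT) :
    M.G ρ ‖(1 / 2 : ℝ) • (a + b)‖ ≤ (M.G ρ ‖a‖ + M.G ρ ‖b‖) / 2 := by
  refine (M.G_mono hρ (norm_nonneg _) ?_).trans (M.G_midpoint hρ _ _)
  rw [norm_smul, Real.norm_of_nonneg (by norm_num)]
  linarith [norm_add_le a b]

theorem abs_sqrt_add_sq_sub_le (ρ r s : ℝ) :
    |√(ρ ^ 2 + r ^ 2) - √(ρ ^ 2 + s ^ 2)| ≤ |r - s| := by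
  have key : ∀ r s : ℝ, √(ρ ^ 2 + r ^ 2) ≤ √(ρ ^ 2 + s ^ 2) + |r - s| := by
    intro r s
    apply Real.sqrt_le_iff.2
    refine ⟨by positivity, ?_⟩
    have h1 := Real.sq_sqrt (show 0 ≤ ρ ^ 2 + s ^ 2 by positivity)
    have h2 : |s| ≤ √(ρ ^ 2 + s ^ 2) :=
      Real.le_sqrt_of_sq_le (by rw [sq_abs]; nlinarith [sq_nonneg ρ])
    have h3 : s * (r - s) ≤ √(ρ ^ 2 + s ^ 2) * |r - s| :=
      (le_abs_self _).trans (by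
        rw [abs_mul]; exact mul_le_mul_of_nonneg_right h2 (abs_nonneg _))
    nlinarith [sq_abs (r - s)]
  rw [abs_sub_le_iff]
  constructor
  · linarith [key r s]
  · linarith [key s r, abs_sub_comm r s]

theorem exists_lipschitzWith_G (ρ : ℝ) :
    ∃ K : ℝ≥0, LipschitzWith K fun a : DevT => M.G ρ ‖a‖ := by
  obtain ⟨K, hK⟩ := M.exists_lipschitzWith_φ
  refine ⟨(M.c₁ + K / |ρ|).toNNReal, LipschitzWith.of_dist_le_mul fun a b => ?_⟩
  have hpos : 0 ≤ M.c₁ + K / |ρ| := add_nonneg M.c₁_pos.le (by positivity)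
  rw [Real.coe_toNNReal _ hpos, Real.dist_eq]
  have h1 := abs_sqrt_add_sq_sub_le ρ ‖a‖ ‖b‖
  have h2 := hK.dist_le_mul ‖a‖ ‖b‖
  rw [Real.dist_eq, Real.dist_eq] at h2
  have h3 : |‖a‖ - ‖b‖| ≤ dist a b := by
    rw [dist_eq_norm]; exact abs_norm_sub_norm_le a b
  have e : M.G ρ ‖a‖ - M.G ρ ‖b‖ = M.c₁ * (√(ρ ^ 2 + ‖a‖ ^ 2) - √(ρ ^ 2 + ‖b‖ ^ 2))
      + (M.φ ‖a‖ - M.φ ‖b‖) / ρ := by simp only [G]; ring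
  rw [e]
  refine (abs_add_le _ _).trans ?_
  rw [abs_mul, abs_of_pos M.c₁_pos, abs_div, add_mul]
  refine add_le_add (mul_le_mul_of_nonneg_left (h1.trans h3) M.c₁_pos.le) ?_
  rw [div_mul_eq_mul_div]
  exact div_le_div_of_nonneg_right
    (h2.trans (mul_le_mul_of_nonneg_left h3 K.2)) (abs_nonneg _)

theorem F_eq_ofReal {ρ : ℝ} (a : DevT) (h : ρ = 0 → ‖a‖ ≤ M.c₃) :
    M.F ρ a = ENNReal.ofReal (M.G ρ ‖a‖ + M.c₂ * ‖a‖ ^ 2) := by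
  unfold F
  split_ifs with h1 h2
  · rw [h1, M.G_zero_left (norm_nonneg _)]
  · exact absurd (h h1) h2
  · congr 1; simp only [G]; ring

theorem F_eq_top {ρ : ℝ} {a : DevT} (hρ : ρ = 0) (h : ¬ ‖a‖ ≤ M.c₃) : M.F ρ a = ⊤ := by
  rw [F, if_pos hρ, if_neg h]

/-! ### The dissipation potential -/

theorem D_zero : M.D 0 = 0 := by simpa using M.D_homogeneous 0 0 le_rfl

theorem D_nonneg (a : DevT) : 0 ≤ M.D a := by
  obtain ⟨c, hc, h⟩ := M.D_coercive
  exact (mul_nonneg hc.le (norm_nonneg a)).trans (h a)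

theorem D_midpoint (a b : DevT) : M.D ((1 / 2 : ℝ) • (a + b)) ≤ (M.D a + M.D b) / 2 := by
  rw [M.D_homogeneous _ _ (by norm_num)]
  linarith [M.D_triangle a b]

/-- A sublinear function on a finite-dimensional space is bounded by a multiple of the norm. -/
theorem exists_D_le : ∃ K : ℝ, 0 ≤ K ∧ ∀ a : DevT, M.D a ≤ K * ‖a‖ := by
  set b := Module.finBasis ℝ DevT
  set T : DevT →L[ℝ] (Fin (Module.finrank ℝ DevT) → ℝ) :=
    LinearMap.toContinuousLinearMap b.equivFun.toLinearMap
  have hsum : ∀ (s : Finset (Fin (Module.finrank ℝ DevT)))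
      (v : Fin (Module.finrank ℝ DevT) → DevT), M.D (∑ i ∈ s, v i) ≤ ∑ i ∈ s, M.D (v i) := by
    intro s v
    induction s using Finset.cons_induction with
    | empty => simp [M.D_zero]
    | cons i s hi ih =>
      rw [Finset.sum_cons, Finset.sum_cons]
      exact (M.D_triangle _ _).trans (by linarith)
  have hone : ∀ (c : ℝ) (v : DevT), M.D (c • v) ≤ |c| * (M.D v + M.D (-v)) := by
    intro c v
    rcases le_total 0 c with hc | hc
    · rw [M.D_homogeneous _ _ hc, abs_of_nonneg hc]
      exact mul_le_mul_of_nonneg_left (by linarith [M.D_nonneg (-v)]) hc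
    · have e : c • v = (-c) • (-v) := by simp
      rw [e, M.D_homogeneous _ _ (by linarith), abs_of_nonpos hc]
      exact mul_le_mul_of_nonneg_left (by linarith [M.D_nonneg v]) (by linarith)
  refine ⟨∑ i, ‖T‖ * (M.D (b i) + M.D (-b i)), Finset.sum_nonneg fun i _ =>
    mul_nonneg T.opNorm_nonneg (add_nonneg (M.D_nonneg _) (M.D_nonneg _)), fun a => ?_⟩
  have e : a = ∑ i, (T a i) • b i := (b.sum_equivFun a).symm
  calc M.D a = M.D (∑ i, (T a i) • b i) := by rw [← e]
    _ ≤ ∑ i, M.D ((T a i) • b i) := hsum _ _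
    _ ≤ ∑ i, (‖T‖ * (M.D (b i) + M.D (-b i))) * ‖a‖ := by
        refine Finset.sum_le_sum fun i _ => (hone _ _).trans ?_
        have h1 : |T a i| ≤ ‖T‖ * ‖a‖ :=
          (norm_le_pi_norm (T a) i).trans (T.le_opNorm a)
        nlinarith [mul_le_mul_of_nonneg_right h1
          (add_nonneg (M.D_nonneg (b i)) (M.D_nonneg (-b i)))]
    _ = _ := by rw [Finset.sum_mul]

theorem exists_lipschitzWith_D : ∃ K : ℝ≥0, LipschitzWith K M.D := by
  obtain ⟨K, hK, h⟩ := M.exists_D_le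
  refine ⟨⟨K, hK⟩, LipschitzWith.of_le_add_mul _ fun a b => ?_⟩
  have h1 := M.D_triangle b (a - b)
  rw [add_sub_cancel] at h1
  rw [dist_eq_norm]
  exact h1.trans (add_le_add_right (h (a - b)) _)

/-! ### The elasticity tensor -/

/-- The elasticity tensor as a continuous linear map. -/
def CL : SymT →L[ℝ] SymT := LinearMap.toContinuousLinearMap M.C

theorem exists_C_coercive : ∃ κ : ℝ, 0 < κ ∧ ∀ a : SymT, κ * ‖a‖ ^ 2 ≤ inner ℝ (M.CL a) a :=
  exists_coercive M.CL M.C_pos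

end Material

/-! ### Weak gradients -/

section WeakGradient

variable {V : Type*} [NormedAddCommGroup V] [NormedSpace ℝ V] {Ω : Set E3}

theorem continuous_integral_smul {W : Type*} [NormedAddCommGroup W] [NormedSpace ℝ W]
    [CompleteSpace W] {ψ : E3 → ℝ} (hψ : Continuous ψ) (hc : HasCompactSupport ψ) :
    Continuous fun u : L2 Ω W => ∫ x in Ω, ψ x • u x := by
  have hm : MemLp ψ 2 ((volume : Measure E3).restrict Ω) := hψ.memLp_of_hasCompactSupport hc
  have h := ((ContinuousLinearMap.lsmul ℝ ℝ : ℝ →L[ℝ] W →L[ℝ] W).lpPairing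
    ((volume : Measure E3).restrict Ω) 2 2 hm.toLp).continuous
  refine h.congr fun u => ?_
  rw [ContinuousLinearMap.lpPairing_eq_integral]
  refine integral_congr_ae ?_
  filter_upwards [hm.coeFn_toLp] with x hx
  rw [hx]; rfl

/-- The space of pairs `(u, ∇u)` is closed: the defining identities pass to limits in `L²`. -/
theorem isClosed_H1 [CompleteSpace V] :
    IsClosed (H1 Ω V : Set (WithLp 2 (L2 Ω V × L2 Ω (Grad V)))) := by
  have e : (H1 Ω V : Set (WithLp 2 (L2 Ω V × L2 Ω (Grad V)))) =
      {p | ∀ φ : E3 → ℝ, ContDiff ℝ ∞ φ → HasCompactSupport φ → tsupport φ ⊆ Ω → ∀ k : Fin 3,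
        ∫ x in Ω, (fderiv ℝ φ x (EuclideanSpace.single k 1)) • p.fst x
          = - ∫ x in Ω, φ x • (p.snd x) k} := rfl
  rw [e]
  simp only [Set.ofPred_forall]
  refine isClosed_iInter fun φ => isClosed_iInter fun hφ => isClosed_iInter fun hc =>
    isClosed_iInter fun _ => isClosed_iInter fun k => ?_
  have h1 : Continuous fun p : WithLp 2 (L2 Ω V × L2 Ω (Grad V)) => p.fst := by fun_prop
  have h2 : Continuous fun p : WithLp 2 (L2 Ω V × L2 Ω (Grad V)) => p.snd := by fun_prop
  have h3 : Continuous fun G : L2 Ω (Grad V) => ∫ x in Ω, φ x • (G x) k := by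
    have h := (continuous_integral_smul (Ω := Ω) (W := V) hφ.continuous hc).comp
      ((PiLp.proj (𝕜 := ℝ) 2 (fun _ : Fin 3 => V) k).compLpL 2
        ((volume : Measure E3).restrict Ω)).continuous
    refine h.congr fun G => integral_congr_ae ?_
    filter_upwards [ContinuousLinearMap.coeFn_compLpL (p := 2)
      (PiLp.proj (𝕜 := ℝ) 2 (fun _ : Fin 3 => V) k) G] with x hx
    rw [hx]; rfl
  exact isClosed_eq ((continuous_integral_smul (continuous_partial hφ _)
    (hasCompactSupport_partial hc _)).comp h1) (h3.comp h2).neg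

instance [CompleteSpace V] : CompleteSpace (H1 Ω V) := isClosed_H1.completeSpace_coe

/-- Two weak gradients of the same function coincide, by the fundamental lemma of the calculus of
variations. -/
theorem IsWeakGradient.unique [CompleteSpace V] (hΩ : IsOpen Ω) {u : L2 Ω V}
    {G H : L2 Ω (Grad V)} (hG : IsWeakGradient Ω u G) (hH : IsWeakGradient Ω u H) : G = H := by
  have key : ∀ k : Fin 3, ∀ᵐ x ∂((volume : Measure E3).restrict Ω), (G x) k = (H x) k := by
    intro k
    have h1 : LocallyIntegrable (fun x => (G x) k - (H x) k)
        ((volume : Measure E3).restrict Ω) := by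
      have h2 := ((Lp.memLp ((PiLp.proj (𝕜 := ℝ) 2 (fun _ : Fin 3 => V) k).compLp
        (G - H))).locallyIntegrable one_le_two)
      refine h2.congr ?_
      filter_upwards [ContinuousLinearMap.coeFn_compLp
        (PiLp.proj (𝕜 := ℝ) 2 (fun _ : Fin 3 => V) k) (G - H), Lp.coeFn_sub G H] with x hx hx'
      rw [hx, hx']; rfl
    have h3 := hΩ.ae_eq_zero_of_integral_contDiff_smul_eq_zero
      (μ := (volume : Measure E3).restrict Ω) (h1.locallyIntegrableOn Ω) fun φ hφ hc hs => by
        simp only [smul_sub]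
        rw [integral_sub (integrable_smul_L2_apply G hφ.continuous hc k)
          (integrable_smul_L2_apply H hφ.continuous hc k)]
        have := (hG φ hφ hc hs k).symm.trans (hH φ hφ hc hs k)
        rw [neg_inj] at this
        rw [this, sub_self]
    filter_upwards [h3, ae_restrict_mem hΩ.measurableSet] with x hx hx'
    exact sub_eq_zero.1 (hx hx')
  apply Lp.ext
  filter_upwards [ae_all_iff.2 key] with x hx
  exact PiLp.ext hx

theorem toL2_add (u v : H1 Ω V) : toL2 (u + v) = toL2 u + toL2 v := rfl
theorem toL2_sub (u v : H1 Ω V) : toL2 (u - v) = toL2 u - toL2 v := rfl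
theorem toL2_smul (c : ℝ) (u : H1 Ω V) : toL2 (c • u) = c • toL2 u := rfl
theorem weakGrad_add (u v : H1 Ω V) : weakGrad (u + v) = weakGrad u + weakGrad v := rfl
theorem weakGrad_sub (u v : H1 Ω V) : weakGrad (u - v) = weakGrad u - weakGrad v := rfl
theorem weakGrad_smul (c : ℝ) (u : H1 Ω V) : weakGrad (c • u) = c • weakGrad u := rfl

theorem norm_sq_H1 (u : H1 Ω V) : ‖u‖ ^ 2 = ‖toL2 u‖ ^ 2 + ‖weakGrad u‖ ^ 2 :=
  WithLp.prod_norm_sq_eq_of_L2 u.1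

theorem toL2_injective [CompleteSpace V] (hΩ : IsOpen Ω) :
    Function.Injective (toL2 : H1 Ω V → L2 Ω V) := by
  intro u v h
  have h1 : IsWeakGradient Ω (toL2 u) (weakGrad v) := by rw [h]; exact v.2
  apply Subtype.ext
  apply WithLp.ofLp_injective
  exact Prod.ext h (IsWeakGradient.unique hΩ u.2 h1)

open Classical in
/-- The weak gradient of a function in `H¹(Ω; V)`, extended by `0` to the other functions in
`L²(Ω; V)`. -/
def gradL2 (z : L2 Ω V) : L2 Ω (Grad V) := if h : IsH1 z then weakGrad h.choose else 0

theorem gradL2_toL2 [CompleteSpace V] (hΩ : IsOpen Ω) (Z : H1 Ω V) :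
    gradL2 (toL2 Z) = weakGrad Z := by
  have h : IsH1 (toL2 Z) := ⟨Z, rfl⟩
  rw [gradL2, dif_pos h, toL2_injective hΩ h.choose_spec]

theorem gradEnergy_eq [CompleteSpace V] (hΩ : IsOpen Ω) {z : L2 Ω V} (hz : IsH1 z) :
    gradEnergy z = ENNReal.ofReal (‖gradL2 z‖ ^ 2) := by
  obtain ⟨Z, rfl⟩ := hz
  rw [gradL2_toL2 hΩ]
  refine le_antisymm (iInf_le_of_le Z (iInf_le_of_le rfl le_rfl)) (le_iInf₂ fun Z' h => ?_)
  rw [toL2_injective hΩ h]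

theorem isH1_zero : IsH1 (0 : L2 Ω V) := ⟨0, rfl⟩

theorem IsH1.add {z w : L2 Ω V} (hz : IsH1 z) (hw : IsH1 w) : IsH1 (z + w) := by
  obtain ⟨Z, rfl⟩ := hz; obtain ⟨W, rfl⟩ := hw; exact ⟨Z + W, rfl⟩

theorem IsH1.sub {z w : L2 Ω V} (hz : IsH1 z) (hw : IsH1 w) : IsH1 (z - w) := by
  obtain ⟨Z, rfl⟩ := hz; obtain ⟨W, rfl⟩ := hw; exact ⟨Z - W, rfl⟩

theorem IsH1.smul {z : L2 Ω V} (hz : IsH1 z) (c : ℝ) : IsH1 (c • z) := by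
  obtain ⟨Z, rfl⟩ := hz; exact ⟨c • Z, rfl⟩

section

variable [CompleteSpace V] {z w : L2 Ω V}

theorem gradL2_add (hΩ : IsOpen Ω) (hz : IsH1 z) (hw : IsH1 w) :
    gradL2 (z + w) = gradL2 z + gradL2 w := by
  obtain ⟨Z, rfl⟩ := hz; obtain ⟨W, rfl⟩ := hw
  rw [← toL2_add]; simp only [gradL2_toL2 hΩ, weakGrad_add]

theorem gradL2_sub (hΩ : IsOpen Ω) (hz : IsH1 z) (hw : IsH1 w) :
    gradL2 (z - w) = gradL2 z - gradL2 w := by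
  obtain ⟨Z, rfl⟩ := hz; obtain ⟨W, rfl⟩ := hw
  rw [← toL2_sub]; simp only [gradL2_toL2 hΩ, weakGrad_sub]

theorem gradL2_smul (hΩ : IsOpen Ω) (hz : IsH1 z) (c : ℝ) : gradL2 (c • z) = c • gradL2 z := by
  obtain ⟨Z, rfl⟩ := hz
  rw [← toL2_smul]; simp only [gradL2_toL2 hΩ, weakGrad_smul]

end

theorem MemSobolev.sub {ν : ℝ} {z w : L2 Ω V} (hz : MemSobolev ν z) (hw : MemSobolev ν w) :
    MemSobolev ν (z - w) := fun h => (hz h).sub (hw h)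

theorem MemSobolev.midpoint {ν : ℝ} {z w : L2 Ω V} (hz : MemSobolev ν z) (hw : MemSobolev ν w) :
    MemSobolev ν ((1 / 2 : ℝ) • (z + w)) := fun h => ((hz h).add (hw h)).smul _

/-- The parallelogram identity, in terms of the midpoint. -/
theorem norm_midpoint_sq {H : Type*} [NormedAddCommGroup H] [InnerProductSpace ℝ H] (a b : H) :
    ‖(1 / 2 : ℝ) • (a + b)‖ ^ 2 + 1 / 4 * ‖a - b‖ ^ 2 = (‖a‖ ^ 2 + ‖b‖ ^ 2) / 2 := by
  rw [norm_smul, Real.norm_of_nonneg (by norm_num), mul_pow, norm_add_sq_real, norm_sub_sq_real]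
  ring

end WeakGradient

/-! ### Fields vanishing on a part of the boundary -/

section Trace

variable {Ω Γ : Set E3}

theorem continuous_classicalGrad {φ : E3 → E3} (hφ : ContDiff ℝ ∞ φ) :
    Continuous (classicalGrad φ) := by
  refine (PiLp.continuous_toLp 2 _).comp (continuous_pi fun k => ?_)
  exact (hφ.continuous_fderiv (by simp)).clm_apply continuous_const

theorem classicalGrad_add {φ ψ : E3 → E3} (hφ : ContDiff ℝ ∞ φ) (hψ : ContDiff ℝ ∞ ψ) (x : E3) :
    classicalGrad (φ + ψ) x = classicalGrad φ x + classicalGrad ψ x := by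
  refine PiLp.ext fun k => ?_
  simp only [classicalGrad, PiLp.add_apply]
  rw [fderiv_add (hφ.differentiable (by simp) x) (hψ.differentiable (by simp) x)]
  rfl

theorem classicalGrad_smul (c : ℝ) {φ : E3 → E3} (hφ : ContDiff ℝ ∞ φ) (x : E3) :
    classicalGrad (c • φ) x = c • classicalGrad φ x := by
  refine PiLp.ext fun k => ?_
  simp only [classicalGrad, PiLp.smul_apply]
  rw [fderiv_const_smul (hφ.differentiable (by simp) x)]
  rfl

/-- A field vanishes on `Γ` if and only if it is approximated arbitrarily well by smooth fields
that are small in `L²(Γ)`. -/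
theorem vanishesOn_iff {u : H1 Ω E3} : VanishesOn Ω Γ u ↔ ∀ ε : ℝ≥0∞, 0 < ε →
    ∃ φ : E3 → E3, ContDiff ℝ ∞ φ ∧
      eLpNorm (fun x => φ x - toL2 u x) 2 (volume.restrict Ω) < ε ∧
      eLpNorm (fun x => classicalGrad φ x - weakGrad u x) 2 (volume.restrict Ω) < ε ∧
      eLpNorm φ 2 ((Measure.hausdorffMeasure 2 : Measure E3).restrict Γ) < ε := by
  have hcongr : ∀ φ : E3 → E3, eLpNorm (fun x => φ x -
      (0 : Lp E3 2 ((Measure.hausdorffMeasure 2 : Measure E3).restrict Γ)) x) 2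
        ((Measure.hausdorffMeasure 2 : Measure E3).restrict Γ) =
      eLpNorm φ 2 ((Measure.hausdorffMeasure 2 : Measure E3).restrict Γ) := by
    intro φ
    refine eLpNorm_congr_ae ?_
    filter_upwards [Lp.coeFn_zero E3 2
      ((Measure.hausdorffMeasure 2 : Measure E3).restrict Γ)] with x hx
    rw [hx]; simp
  constructor
  · rintro ⟨φ, hφ, h1, h2, h3⟩ ε hε
    simp only [hcongr] at h3
    obtain ⟨n, hn1, hn2, hn3⟩ := ((h1.eventually_lt_const hε).and
      ((h2.eventually_lt_const hε).and (h3.eventually_lt_const hε))).exists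
    exact ⟨φ n, hφ n, hn1, hn2, hn3⟩
  · intro h
    have hpos : ∀ n : ℕ, (0 : ℝ≥0∞) < (n : ℝ≥0∞)⁻¹ := fun n =>
      ENNReal.inv_pos.2 (ENNReal.natCast_ne_top n)
    choose φ hφ h1 h2 h3 using fun n : ℕ => h _ (hpos n)
    have hlim := ENNReal.tendsto_inv_nat_nhds_zero
    refine ⟨φ, hφ, ?_, ?_, ?_⟩
    · exact tendsto_of_tendsto_of_tendsto_of_le_of_le tendsto_const_nhds hlim
        (fun _ => zero_le) fun n => (h1 n).le
    · exact tendsto_of_tendsto_of_tendsto_of_le_of_le tendsto_const_nhds hlim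
        (fun _ => zero_le) fun n => (h2 n).le
    · simp only [hcongr]
      exact tendsto_of_tendsto_of_tendsto_of_le_of_le tendsto_const_nhds hlim
        (fun _ => zero_le) fun n => (h3 n).le

theorem vanishesOn_zero : VanishesOn Ω Γ 0 := by
  refine vanishesOn_iff.2 fun ε hε => ⟨0, contDiff_const, ?_, ?_, by simpa using hε⟩
  · refine lt_of_eq_of_lt ?_ hε
    rw [← eLpNorm_zero (ε := E3) (p := 2) (μ := (volume : Measure E3).restrict Ω)]
    refine eLpNorm_congr_ae ?_
    filter_upwards [Lp.coeFn_zero E3 2 ((volume : Measure E3).restrict Ω)] with x hx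
    have : toL2 (0 : H1 Ω E3) = 0 := rfl
    rw [this, hx]; simp
  · refine lt_of_eq_of_lt ?_ hε
    rw [← eLpNorm_zero (ε := Grad E3) (p := 2) (μ := (volume : Measure E3).restrict Ω)]
    refine eLpNorm_congr_ae ?_
    filter_upwards [Lp.coeFn_zero (Grad E3) 2 ((volume : Measure E3).restrict Ω)] with x hx
    have e1 : weakGrad (0 : H1 Ω E3) = 0 := rfl
    have e2 : classicalGrad 0 x = 0 := by
      refine PiLp.ext fun k => ?_
      simp [classicalGrad]
    rw [e1, hx, e2]; simp

theorem eLpNorm_sub_add_le {W : Type*} [NormedAddCommGroup W] {α : Type*} [MeasurableSpace α]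
    {μ : Measure α} {f g : α → W} (hf : AEStronglyMeasurable f μ) (hg : AEStronglyMeasurable g μ)
    (u v : Lp W 2 μ) : eLpNorm (fun x => (f x + g x) - (u + v : Lp W 2 μ) x) 2 μ ≤
      eLpNorm (fun x => f x - u x) 2 μ + eLpNorm (fun x => g x - v x) 2 μ := by
  refine le_of_eq_of_le ?_ (eLpNorm_add_le (hf.sub (Lp.aestronglyMeasurable u))
    (hg.sub (Lp.aestronglyMeasurable v)) one_le_two)
  refine eLpNorm_congr_ae ?_
  filter_upwards [Lp.coeFn_add u v] with x hx
  rw [hx]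
  simp only [Pi.add_apply]
  abel

theorem eLpNorm_smul_sub_smul {W : Type*} [NormedAddCommGroup W] [NormedSpace ℝ W] {α : Type*}
    [MeasurableSpace α] {μ : Measure α} (f : α → W) (c : ℝ) (u : Lp W 2 μ) :
    eLpNorm (fun x => c • f x - (c • u : Lp W 2 μ) x) 2 μ =
      ‖c‖ₑ * eLpNorm (fun x => f x - u x) 2 μ := by
  rw [← eLpNorm_const_smul]
  refine eLpNorm_congr_ae ?_
  filter_upwards [Lp.coeFn_smul c u] with x hx
  rw [hx]
  simp only [Pi.smul_apply, smul_sub]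

theorem VanishesOn.add {u v : H1 Ω E3} (hu : VanishesOn Ω Γ u) (hv : VanishesOn Ω Γ v) :
    VanishesOn Ω Γ (u + v) := by
  refine vanishesOn_iff.2 fun ε hε => ?_
  have hε2 : 0 < ε / 2 := ENNReal.half_pos hε.ne'
  obtain ⟨φ, hφ, h1, h2, h3⟩ := vanishesOn_iff.1 hu _ hε2
  obtain ⟨ψ, hψ, k1, k2, k3⟩ := vanishesOn_iff.1 hv _ hε2
  refine ⟨φ + ψ, hφ.add hψ, ?_, ?_, ?_⟩
  · rw [toL2_add, ← ENNReal.add_halves ε]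
    exact (eLpNorm_sub_add_le hφ.continuous.aestronglyMeasurable
      hψ.continuous.aestronglyMeasurable _ _).trans_lt (ENNReal.add_lt_add h1 k1)
  · rw [weakGrad_add, ← ENNReal.add_halves ε]
    simp only [classicalGrad_add hφ hψ]
    exact (eLpNorm_sub_add_le (continuous_classicalGrad hφ).aestronglyMeasurable
      (continuous_classicalGrad hψ).aestronglyMeasurable _ _).trans_lt (ENNReal.add_lt_add h2 k2)
  · rw [← ENNReal.add_halves ε]
    exact (eLpNorm_add_le hφ.continuous.aestronglyMeasurable
      hψ.continuous.aestronglyMeasurable one_le_two).trans_lt (ENNReal.add_lt_add h3 k3)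

theorem VanishesOn.smul {u : H1 Ω E3} (hu : VanishesOn Ω Γ u) (c : ℝ) :
    VanishesOn Ω Γ (c • u) := by
  obtain ⟨φ, hφ, h1, h2, h3⟩ := hu
  have hc : ∀ f : ℕ → ℝ≥0∞, Tendsto f atTop (𝓝 0) →
      Tendsto (fun n => ‖c‖ₑ * f n) atTop (𝓝 0) := fun f hf => by
    simpa using ENNReal.Tendsto.const_mul hf (Or.inr (enorm_ne_top (x := c)))
  refine ⟨fun n => c • φ n, fun n => contDiff_const.smul (hφ n), ?_, ?_, ?_⟩
  · have h := hc _ h1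
    simp only [← eLpNorm_smul_sub_smul] at h
    exact h
  · have h := hc _ h2
    simp only [← eLpNorm_smul_sub_smul] at h
    simp only [classicalGrad_smul c (hφ _)]
    exact h
  · have h := hc _ h3
    simp only [← eLpNorm_smul_sub_smul] at h
    rw [smul_zero] at h
    exact h

/-- The fields in `H¹(Ω; ℝ³)` that vanish on `Γ` form a closed subspace. -/
theorem isClosed_vanishesOn : IsClosed {u : H1 Ω E3 | VanishesOn Ω Γ u} := by
  refine isClosed_of_closure_subset fun u hu => vanishesOn_iff.2 fun ε hε => ?_
  have hε2 : 0 < ε / 2 := ENNReal.half_pos hε.ne'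
  obtain ⟨v, hv, huv⟩ := EMetric.mem_closure_iff.1 hu _ hε2
  have hv' : VanishesOn Ω Γ v := hv
  have hw1 : eLpNorm (fun x => (0 : E3) - toL2 (u - v) x) 2 (volume.restrict Ω) < ε / 2 := by
    have e : eLpNorm (fun x => (0 : E3) - toL2 (u - v) x) 2 (volume.restrict Ω)
        = ‖toL2 (u - v)‖ₑ := by
      rw [Lp.enorm_def, ← eLpNorm_neg]
      congr 1; funext x; simp
    rw [e]
    refine lt_of_le_of_lt ?_ huv
    rw [edist_eq_enorm_sub, enorm_le_iff_norm_le]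
    have h := norm_sq_H1 (u - v)
    nlinarith [norm_nonneg (u - v), sq_nonneg ‖weakGrad (u - v)‖, norm_nonneg (toL2 (u - v))]
  have hw2 : eLpNorm (fun x => (0 : Grad E3) - weakGrad (u - v) x) 2 (volume.restrict Ω)
      < ε / 2 := by
    have e : eLpNorm (fun x => (0 : Grad E3) - weakGrad (u - v) x) 2 (volume.restrict Ω)
        = ‖weakGrad (u - v)‖ₑ := by
      rw [Lp.enorm_def, ← eLpNorm_neg]
      congr 1; funext x; simp
    rw [e]
    refine lt_of_le_of_lt ?_ huv
    rw [edist_eq_enorm_sub, enorm_le_iff_norm_le]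
    have h := norm_sq_H1 (u - v)
    nlinarith [norm_nonneg (u - v), sq_nonneg ‖toL2 (u - v)‖, norm_nonneg (weakGrad (u - v))]
  obtain ⟨φ, hφ, h1, h2, h3⟩ := vanishesOn_iff.1 hv' _ hε2
  have e : u = v + (u - v) := by abel
  refine ⟨φ, hφ, ?_, ?_, h3.trans_le ENNReal.half_le_self⟩
  · rw [e, toL2_add, ← ENNReal.add_halves ε]
    refine lt_of_le_of_lt ?_ (ENNReal.add_lt_add h1 hw1)
    simpa using eLpNorm_sub_add_le (μ := (volume : Measure E3).restrict Ω)
      hφ.continuous.aestronglyMeasurable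
      (aestronglyMeasurable_const (b := (0 : E3))) (toL2 v) (toL2 (u - v))
  · rw [e, weakGrad_add, ← ENNReal.add_halves ε]
    refine lt_of_le_of_lt ?_ (ENNReal.add_lt_add h2 hw2)
    simpa using eLpNorm_sub_add_le (μ := (volume : Measure E3).restrict Ω)
      (continuous_classicalGrad hφ).aestronglyMeasurable
      (aestronglyMeasurable_const (b := (0 : Grad E3))) (weakGrad v) (weakGrad (u - v))

end Trace

/-! ### Integral functionals and quadratic forms on `L²` -/

section IntegralFunctional

variable {α : Type*} [MeasurableSpace α] {μ : Measure α} {V : Type*} [NormedAddCommGroup V]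

theorem integrable_lipschitz_comp [IsFiniteMeasure μ] {g : V → ℝ} {K : ℝ≥0}
    (hg : LipschitzWith K g) (g0 : g 0 = 0) (z : Lp V 2 μ) : Integrable (fun x => g (z x)) μ :=
  ((Lp.memLp (hg.compLp g0 z)).integrable one_le_two).congr (hg.coeFn_compLp g0 z)

theorem continuous_integral_lipschitz_comp [IsFiniteMeasure μ] {g : V → ℝ} {K : ℝ≥0}
    (hg : LipschitzWith K g) (g0 : g 0 = 0) : Continuous fun z : Lp V 2 μ => ∫ x, g (z x) ∂μ := by
  have hm : MemLp (fun _ : α => (1 : ℝ)) 2 μ := memLp_const 1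
  have h := ((ContinuousLinearMap.mul ℝ ℝ).lpPairing μ 2 2 hm.toLp).continuous.comp
    (hg.continuous_compLp g0 (μ := μ) (p := 2))
  refine h.congr fun z => ?_
  rw [Function.comp_apply, ContinuousLinearMap.lpPairing_eq_integral]
  refine integral_congr_ae ?_
  filter_upwards [hm.coeFn_toLp, hg.coeFn_compLp g0 z] with x hx hx'
  rw [hx, hx']; simp

theorem integral_midpoint_le [NormedSpace ℝ V] [IsFiniteMeasure μ] {g : V → ℝ} {K : ℝ≥0}
    (hg : LipschitzWith K g) (g0 : g 0 = 0)
    (hmid : ∀ a b, g ((1 / 2 : ℝ) • (a + b)) ≤ (g a + g b) / 2) (z w : Lp V 2 μ) :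
    ∫ x, g (((1 / 2 : ℝ) • (z + w) : Lp V 2 μ) x) ∂μ
      ≤ ((∫ x, g (z x) ∂μ) + ∫ x, g (w x) ∂μ) / 2 := by
  have hz := integrable_lipschitz_comp hg g0 z
  have hw := integrable_lipschitz_comp hg g0 w
  rw [← integral_add hz hw, ← integral_div]
  refine integral_mono_ae (integrable_lipschitz_comp hg g0 _) ((hz.add hw).div_const 2) ?_
  filter_upwards [Lp.coeFn_smul (1 / 2 : ℝ) (z + w), Lp.coeFn_add z w] with x h1 h2
  rw [h1, Pi.smul_apply, h2, Pi.add_apply]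
  exact hmid _ _

end IntegralFunctional

section Quadratic

variable {α : Type*} [MeasurableSpace α] {μ : Measure α} {V : Type*} [NormedAddCommGroup V]
  [InnerProductSpace ℝ V]

/-- The quadratic form `½⟨T a, a⟩`. -/
def halfForm {H : Type*} [NormedAddCommGroup H] [InnerProductSpace ℝ H] (T : H →L[ℝ] H) (a : H) :
    ℝ := 1 / 2 * inner ℝ (T a) a

theorem halfForm_midpoint (T : V →L[ℝ] V) (a b : V) :
    halfForm T ((1 / 2 : ℝ) • (a + b)) + 1 / 4 * halfForm T (a - b)
      = (halfForm T a + halfForm T b) / 2 := by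
  simp only [halfForm]
  rw [map_smul, real_inner_smul_left, real_inner_smul_right, map_add, map_sub]
  simp only [inner_add_left, inner_add_right, inner_sub_left, inner_sub_right]
  ring

theorem continuous_halfForm (T : V →L[ℝ] V) : Continuous (halfForm T) :=
  continuous_const.mul (T.continuous.inner continuous_id)

theorem integral_inner_comp_self (C : V →L[ℝ] V) (a : Lp V 2 μ) :
    1 / 2 * ∫ x, (inner ℝ (C (a x)) (a x) : ℝ) ∂μ = halfForm (C.compLpL 2 μ) a := by
  rw [halfForm, L2.inner_def]
  congr 1
  refine integral_congr_ae ?_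
  filter_upwards [C.coeFn_compLpL a] with x hx
  rw [hx]

theorem integrable_norm_sq (a : Lp V 2 μ) : Integrable (fun x => ‖a x‖ ^ 2) μ :=
  (L2.integrable_inner a a (𝕜 := ℝ)).congr
    (Eventually.of_forall fun x => real_inner_self_eq_norm_sq (a x))

theorem integral_norm_sq (a : Lp V 2 μ) : ∫ x, ‖a x‖ ^ 2 ∂μ = ‖a‖ ^ 2 := by
  rw [← real_inner_self_eq_norm_sq, L2.inner_def]
  simp only [real_inner_self_eq_norm_sq]

theorem mul_norm_sq_le_halfForm {C : V →L[ℝ] V} {κ : ℝ}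
    (h : ∀ a : V, κ * ‖a‖ ^ 2 ≤ inner ℝ (C a) a) (a : Lp V 2 μ) :
    κ / 2 * ‖a‖ ^ 2 ≤ halfForm (C.compLpL 2 μ) a := by
  have key : κ * ‖a‖ ^ 2 ≤ ∫ x, (inner ℝ (C (a x)) (a x) : ℝ) ∂μ := by
    rw [← integral_norm_sq, ← integral_const_mul]
    refine integral_mono ((integrable_norm_sq a).const_mul κ) ?_ fun x => h (a x)
    refine (L2.integrable_inner (𝕜 := ℝ) (C.compLpL 2 μ a) a).congr ?_
    filter_upwards [C.coeFn_compLpL a] with x hx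
    rw [hx]
  rw [← integral_inner_comp_self]
  linarith

end Quadratic

/-! ### The strain -/

section Strain

variable {Ω : Set E3}

theorem continuous_weakGrad {V : Type*} [NormedAddCommGroup V] [NormedSpace ℝ V] :
    Continuous (weakGrad : H1 Ω V → L2 Ω (Grad V)) := by
  have h : Continuous fun p : WithLp 2 (L2 Ω V × L2 Ω (Grad V)) => p.snd := by fun_prop
  exact h.comp continuous_subtype_val

theorem continuous_toL2 {V : Type*} [NormedAddCommGroup V] [NormedSpace ℝ V] :
    Continuous (toL2 : H1 Ω V → L2 Ω V) := by
  have h : Continuous fun p : WithLp 2 (L2 Ω V × L2 Ω (Grad V)) => p.fst := by fun_prop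
  exact h.comp continuous_subtype_val

/-- The strain as a continuous linear map. -/
def strainL : H1 Ω E3 →L[ℝ] L2 Ω SymT where
  toFun := strain
  map_add' u v := by
    change symPart.compLpL 2 _ (weakGrad (u + v)) = symPart.compLpL 2 _ (weakGrad u)
      + symPart.compLpL 2 _ (weakGrad v)
    rw [weakGrad_add, map_add]
  map_smul' c u := by
    change symPart.compLpL 2 _ (weakGrad (c • u)) = c • symPart.compLpL 2 _ (weakGrad u)
    rw [weakGrad_smul, map_smul]
  cont := (symPart.compLpL 2 ((volume : Measure E3).restrict Ω)).continuous.comp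
    continuous_weakGrad

/-- The inclusion of `L²(Ω; dev)` into `L²(Ω; sym)`. -/
def embL : L2 Ω DevT →L[ℝ] L2 Ω SymT := devToSym.compLpL 2 _

/-- The elastic strain `ε(u) - z` as a continuous linear map. -/
def elasticStrain : H1 Ω E3 × L2 Ω DevT →L[ℝ] L2 Ω SymT :=
  strainL.comp (ContinuousLinearMap.fst ℝ _ _) - embL.comp (ContinuousLinearMap.snd ℝ _ _)

theorem elasticStrain_apply (y : H1 Ω E3 × L2 Ω DevT) :
    elasticStrain y = strainL y.1 - embL y.2 := rfl

theorem norm_embL (z : L2 Ω DevT) : ‖(embL z : L2 Ω SymT)‖ ≤ ‖z‖ := by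
  refine Lp.norm_le_norm_of_ae_le ?_
  filter_upwards [devToSym.coeFn_compLp z] with x hx
  have e : (embL z : L2 Ω SymT) x = devToSym (z x) := hx
  rw [e]; rfl

end Strain

/-! ### The energy as a real-valued function -/

namespace Material

variable (M : Material) {Ω : Set E3}

/-- The elastic energy as a function of the state is a continuous quadratic form. -/
def elasticPart (y : H1 Ω E3 × L2 Ω DevT) : ℝ :=
  halfForm (M.CL.compLpL 2 ((volume : Measure E3).restrict Ω)) (elasticStrain y)

theorem elasticEnergy_eq (y : H1 Ω E3 × L2 Ω DevT) :
    M.elasticEnergy (strain y.1 - devToSym.compLp y.2) = M.elasticPart y :=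
  integral_inner_comp_self M.CL (elasticStrain y)

/-- The integral of the part of the inelastic energy density without the quadratic term. -/
def intG (ρ : ℝ) (z : L2 Ω DevT) : ℝ := ∫ x in Ω, M.G ρ ‖z x‖

/-- The incremental functional on the states where it is finite. -/
def energy (ℓ : H1 Ω E3 →L[ℝ] ℝ) (zbar : L2 Ω DevT) (ρ ν : ℝ) (y : H1 Ω E3 × L2 Ω DevT) : ℝ :=
  M.elasticPart y + (M.intG ρ y.2 + M.c₂ * ‖y.2‖ ^ 2) + ν / 2 * ‖gradL2 y.2‖ ^ 2
    + (- ℓ y.1 + M.dissipation (y.2 - zbar))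

theorem exists_elasticPart_coercive : ∃ κ : ℝ, 0 < κ ∧ ∀ y : H1 Ω E3 × L2 Ω DevT,
    κ * ‖elasticStrain y‖ ^ 2 ≤ M.elasticPart y := by
  obtain ⟨κ, hκ, h⟩ := M.exists_C_coercive
  exact ⟨κ / 2, by positivity, fun y => mul_norm_sq_le_halfForm h (elasticStrain y)⟩

theorem elasticPart_nonneg (y : H1 Ω E3 × L2 Ω DevT) : 0 ≤ M.elasticPart y := by
  obtain ⟨κ, hκ, h⟩ := M.exists_elasticPart_coercive (Ω := Ω)
  exact le_trans (by positivity) (h y)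

theorem elasticPart_midpoint (y w : H1 Ω E3 × L2 Ω DevT) :
    M.elasticPart ((1 / 2 : ℝ) • (y + w)) + 1 / 4 * M.elasticPart (y - w)
      = (M.elasticPart y + M.elasticPart w) / 2 := by
  have h := halfForm_midpoint (M.CL.compLpL 2 ((volume : Measure E3).restrict Ω))
    (elasticStrain y) (elasticStrain w)
  simp only [elasticPart, map_smul, map_add, map_sub]
  exact h

theorem continuous_elasticPart : Continuous (M.elasticPart (Ω := Ω)) :=
  (continuous_halfForm _).comp elasticStrain.continuous

theorem intG_nonneg {ρ : ℝ} (hρ : 0 ≤ ρ) (z : L2 Ω DevT) : 0 ≤ M.intG ρ z :=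
  integral_nonneg fun x => M.G_nonneg hρ ‖z x‖

theorem dissipation_nonneg (z : L2 Ω DevT) : 0 ≤ M.dissipation z :=
  integral_nonneg fun x => M.D_nonneg (z x)

section FiniteMeasure

variable [IsFiniteMeasure ((volume : Measure E3).restrict Ω)]

theorem G_norm_zero {ρ : ℝ} (hρ : 0 ≤ ρ) : M.G ρ ‖(0 : DevT)‖ = 0 := by
  rw [norm_zero, M.G_zero_right hρ]

theorem integrable_G {ρ : ℝ} (hρ : 0 ≤ ρ) (z : L2 Ω DevT) :
    Integrable (fun x => M.G ρ ‖z x‖) ((volume : Measure E3).restrict Ω) := by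
  obtain ⟨K, hK⟩ := M.exists_lipschitzWith_G ρ
  exact integrable_lipschitz_comp hK (M.G_norm_zero hρ) z

theorem continuous_intG {ρ : ℝ} (hρ : 0 ≤ ρ) : Continuous (M.intG ρ (Ω := Ω)) := by
  obtain ⟨K, hK⟩ := M.exists_lipschitzWith_G ρ
  exact continuous_integral_lipschitz_comp hK (M.G_norm_zero hρ)

theorem intG_midpoint {ρ : ℝ} (hρ : 0 ≤ ρ) (z w : L2 Ω DevT) :
    M.intG ρ ((1 / 2 : ℝ) • (z + w)) ≤ (M.intG ρ z + M.intG ρ w) / 2 := by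
  obtain ⟨K, hK⟩ := M.exists_lipschitzWith_G ρ
  exact integral_midpoint_le hK (M.G_norm_zero hρ) (M.G_norm_midpoint hρ) z w

theorem intG_anti {σ ρ : ℝ} (hσ : 0 < σ) (h : σ ≤ ρ) (z : L2 Ω DevT) :
    M.intG ρ z ≤ M.intG σ z :=
  integral_mono (M.integrable_G (hσ.le.trans h) z) (M.integrable_G hσ.le z)
    fun x => M.G_anti hσ h ‖z x‖

theorem intG_le_intG_zero {ρ : ℝ} (hρ : 0 ≤ ρ) {z : L2 Ω DevT}
    (hz : ∀ᵐ x ∂((volume : Measure E3).restrict Ω), ‖z x‖ ≤ M.c₃) :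
    M.intG ρ z ≤ M.intG 0 z := by
  refine integral_mono_ae (M.integrable_G hρ z) (M.integrable_G le_rfl z) ?_
  filter_upwards [hz] with x hx using M.G_le_G_zero hρ hx

theorem continuous_dissipation : Continuous (M.dissipation (Ω := Ω)) := by
  obtain ⟨K, hK⟩ := M.exists_lipschitzWith_D
  exact continuous_integral_lipschitz_comp hK M.D_zero

theorem dissipation_midpoint (z w zbar : L2 Ω DevT) :
    M.dissipation ((1 / 2 : ℝ) • (z + w) - zbar)
      ≤ (M.dissipation (z - zbar) + M.dissipation (w - zbar)) / 2 := by
  obtain ⟨K, hK⟩ := M.exists_lipschitzWith_D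
  have e : (1 / 2 : ℝ) • (z + w) - zbar = (1 / 2 : ℝ) • ((z - zbar) + (w - zbar)) := by module
  rw [e]
  exact integral_midpoint_le hK M.D_zero M.D_midpoint (z - zbar) (w - zbar)

end FiniteMeasure

end Material

/-! ### Convergence and completeness in the state space -/

section States

variable {Ω : Set E3} {W V : Type*} [NormedAddCommGroup W] [NormedSpace ℝ W]
  [NormedAddCommGroup V] [NormedSpace ℝ V]

/-- The square of the norm of `H¹(Ω; W) × H^{j(ν)}(Ω; V)`, with the gradient of the second
component weighted by `ν`. -/
def stateNormSq (ν : ℝ) (y : H1 Ω W × L2 Ω V) : ℝ :=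
  ‖y.1‖ ^ 2 + ‖y.2‖ ^ 2 + ν * ‖gradL2 y.2‖ ^ 2

theorem norm_sq_le_stateNormSq {ν : ℝ} (hν : 0 ≤ ν) (y : H1 Ω W × L2 Ω V) :
    ‖y‖ ^ 2 ≤ stateNormSq ν y := by
  have h : 0 ≤ ν * ‖gradL2 y.2‖ ^ 2 := by positivity
  rw [stateNormSq, Prod.norm_def]
  rcases max_cases ‖y.1‖ ‖y.2‖ with ⟨h1, _⟩ | ⟨h1, _⟩ <;> rw [h1] <;>
    nlinarith [sq_nonneg ‖y.1‖, sq_nonneg ‖y.2‖]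

theorem grad_le_stateNormSq (ν : ℝ) (y : H1 Ω W × L2 Ω V) :
    ν * ‖gradL2 y.2‖ ^ 2 ≤ stateNormSq ν y := by
  rw [stateNormSq]
  nlinarith [sq_nonneg ‖y.1‖, sq_nonneg ‖y.2‖]

theorem stateNormSq_nonneg {ν : ℝ} (hν : 0 ≤ ν) (y : H1 Ω W × L2 Ω V) :
    0 ≤ stateNormSq ν y := (sq_nonneg _).trans (norm_sq_le_stateNormSq hν y)

/-- Strong convergence in `H¹(Ω; W) × H^{j(ν)}(Ω; V)`. -/
def TendstoState {ι : Type*} (ν : ℝ) (x : ι → H1 Ω W × L2 Ω V) (l : Filter ι)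
    (y : H1 Ω W × L2 Ω V) : Prop :=
  Tendsto x l (𝓝 y) ∧ (ν ≠ 0 → Tendsto (fun i => gradL2 (x i).2) l (𝓝 (gradL2 y.2)))

theorem tendsto_zero_of_norm_sq_le {ι X : Type*} [NormedAddCommGroup X] {l : Filter ι}
    {f : ι → X} {N : ι → ℝ} (h : ∀ i, ‖f i‖ ^ 2 ≤ N i) (hN : Tendsto N l (𝓝 0)) :
    Tendsto f l (𝓝 0) := by
  rw [tendsto_zero_iff_norm_tendsto_zero]
  have h1 : Tendsto (fun i => √(N i)) l (𝓝 0) := by simpa using hN.sqrt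
  exact squeeze_zero (fun _ => norm_nonneg _) (fun i => Real.le_sqrt_of_sq_le (h i)) h1

theorem tendsto_mul_norm_sq {ι X : Type*} [NormedAddCommGroup X] {l : Filter ι} {c : ℝ}
    {f : ι → X} {a : X} (h : c ≠ 0 → Tendsto f l (𝓝 a)) :
    Tendsto (fun i => c * ‖f i‖ ^ 2) l (𝓝 (c * ‖a‖ ^ 2)) := by
  by_cases hc : c = 0
  · simp only [hc, zero_mul]; exact tendsto_const_nhds
  · exact ((h hc).norm.pow 2).const_mul c

theorem cauchySeq_of_norm_sq_le {X : Type*} [NormedAddCommGroup X] {f : ℕ → X}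
    (h : ∀ ε > 0, ∃ n₀, ∀ n ≥ n₀, ∀ m ≥ n₀, ‖f n - f m‖ ^ 2 < ε) : CauchySeq f := by
  refine Metric.cauchySeq_iff.2 fun ε hε => ?_
  obtain ⟨n₀, hn⟩ := h (ε ^ 2) (by positivity)
  refine ⟨n₀, fun n hn1 m hm1 => ?_⟩
  rw [dist_eq_norm]
  exact lt_of_pow_lt_pow_left₀ 2 hε.le (hn n hn1 m hm1)

variable [CompleteSpace V]

theorem tendstoState_of_stateNormSq (hΩ : IsOpen Ω) {ι : Type*} {l : Filter ι} {ν : ℝ}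
    (hν : 0 ≤ ν) {x : ι → H1 Ω W × L2 Ω V} {y : H1 Ω W × L2 Ω V}
    (hx : ∀ i, MemSobolev ν (x i).2) (hy : MemSobolev ν y.2)
    (h : Tendsto (fun i => stateNormSq ν (x i - y)) l (𝓝 0)) : TendstoState ν x l y := by
  constructor
  · rw [← tendsto_sub_nhds_zero_iff]
    exact tendsto_zero_of_norm_sq_le (fun i => norm_sq_le_stateNormSq hν _) h
  · intro hν0
    have hpos : 0 < ν := lt_of_le_of_ne hν (Ne.symm hν0)
    rw [← tendsto_sub_nhds_zero_iff]
    refine tendsto_zero_of_norm_sq_le (N := fun i => ν⁻¹ * stateNormSq ν (x i - y))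
      (fun i => ?_) (by simpa using h.const_mul ν⁻¹)
    rw [← gradL2_sub hΩ (hx i hν0) (hy hν0), ← Prod.snd_sub, inv_mul_eq_div, le_div_iff₀ hpos,
      mul_comm]
    exact grad_le_stateNormSq ν _

theorem TendstoState.stateNormSq (hΩ : IsOpen Ω) {ι : Type*} {l : Filter ι} {ν : ℝ}
    {x : ι → H1 Ω W × L2 Ω V} {y : H1 Ω W × L2 Ω V}
    (hx : ∀ i, MemSobolev ν (x i).2) (hy : MemSobolev ν y.2)
    (h : TendstoState ν x l y) : Tendsto (fun i => stateNormSq ν (x i - y)) l (𝓝 0) := by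
  have h1 := tendsto_sub_nhds_zero_iff.2 ((continuous_fst.tendsto y).comp h.1)
  have h2 := tendsto_sub_nhds_zero_iff.2 ((continuous_snd.tendsto y).comp h.1)
  have h3 : Tendsto (fun i => ν * ‖gradL2 (x i - y).2‖ ^ 2) l (𝓝 0) := by
    have h4 := tendsto_mul_norm_sq (c := ν) (f := fun i => gradL2 (x i - y).2) (a := 0)
      fun hν0 => by
        refine (tendsto_sub_nhds_zero_iff.2 (h.2 hν0)).congr fun i => ?_
        rw [← gradL2_sub hΩ (hx i hν0) (hy hν0), ← Prod.snd_sub]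
    simpa using h4
  have h5 := ((h1.norm.pow 2).add (h2.norm.pow 2)).add h3
  have e : ‖(0 : H1 Ω W)‖ ^ 2 + ‖(0 : L2 Ω V)‖ ^ 2 + 0 = (0 : ℝ) := by simp
  rw [e] at h5
  exact h5

/-- The state space is complete: for `ν = 0` it is `H¹ × L²`, and otherwise `H¹ × H¹`. -/
theorem exists_tendstoState_of_cauchy [CompleteSpace W] (hΩ : IsOpen Ω) {ν : ℝ} (hν : 0 ≤ ν)
    {x : ℕ → H1 Ω W × L2 Ω V} (hx : ∀ n, MemSobolev ν (x n).2)
    (h : ∀ ε > 0, ∃ n₀, ∀ n ≥ n₀, ∀ m ≥ n₀, stateNormSq ν (x n - x m) < ε) :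
    ∃ y : H1 Ω W × L2 Ω V, MemSobolev ν y.2 ∧ TendstoState ν x atTop y := by
  have hc : CauchySeq x := cauchySeq_of_norm_sq_le fun ε hε => by
    obtain ⟨n₀, hn⟩ := h ε hε
    exact ⟨n₀, fun n h1 m h2 => (norm_sq_le_stateNormSq hν _).trans_lt (hn n h1 m h2)⟩
  obtain ⟨y, hy⟩ := cauchySeq_tendsto_of_complete hc
  by_cases hν0 : ν = 0
  · exact ⟨y, fun h => absurd hν0 h, hy, fun h => absurd hν0 h⟩
  have hpos : 0 < ν := lt_of_le_of_ne hν (Ne.symm hν0)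
  choose Z hZ using fun n => hx n hν0
  have hcZ : CauchySeq Z := cauchySeq_of_norm_sq_le fun ε hε => by
    obtain ⟨n₀, hn⟩ := h (min (ε / 2) (ν * (ε / 2))) (by positivity)
    refine ⟨n₀, fun n h1 m h2 => ?_⟩
    have h3 := hn n h1 m h2
    have h4 : ‖toL2 (Z n - Z m)‖ ^ 2 ≤ stateNormSq ν (x n - x m) := by
      rw [toL2_sub, hZ, hZ, stateNormSq, ← Prod.snd_sub]
      have : 0 ≤ ν * ‖gradL2 (x n - x m).2‖ ^ 2 := by positivity
      nlinarith [sq_nonneg ‖(x n - x m).1‖]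
    have h5 : ν * ‖weakGrad (Z n - Z m)‖ ^ 2 ≤ stateNormSq ν (x n - x m) := by
      rw [← gradL2_toL2 hΩ, toL2_sub, hZ, hZ, ← Prod.snd_sub]
      exact grad_le_stateNormSq ν _
    have h6 := h3.trans_le (min_le_left _ _)
    have h7 : ‖weakGrad (Z n - Z m)‖ ^ 2 < ε / 2 :=
      lt_of_mul_lt_mul_left (h5.trans_lt (h3.trans_le (min_le_right _ _))) hν
    rw [norm_sq_H1]
    linarith
  obtain ⟨L, hL⟩ := cauchySeq_tendsto_of_complete hcZ
  have h1 : Tendsto (fun n => (x n).2) atTop (𝓝 (toL2 L)) := by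
    simpa only [Function.comp_def, hZ] using (continuous_toL2.tendsto L).comp hL
  have h2 : toL2 L = y.2 := tendsto_nhds_unique h1 ((continuous_snd.tendsto y).comp hy)
  refine ⟨y, fun _ => ⟨L, h2⟩, hy, fun _ => ?_⟩
  rw [← h2, gradL2_toL2 hΩ]
  have h3 := (continuous_weakGrad.tendsto L).comp hL
  refine h3.congr fun n => ?_
  rw [Function.comp_apply, ← gradL2_toL2 hΩ, hZ]

theorem grad_midpoint {V : Type*} [NormedAddCommGroup V] [InnerProductSpace ℝ V]
    [CompleteSpace V] (hΩ : IsOpen Ω) {ν : ℝ} {z w : L2 Ω V} (hz : MemSobolev ν z)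
    (hw : MemSobolev ν w) : ν / 2 * ‖gradL2 ((1 / 2 : ℝ) • (z + w))‖ ^ 2
      + 1 / 8 * (ν * ‖gradL2 (z - w)‖ ^ 2)
      = (ν / 2 * ‖gradL2 z‖ ^ 2 + ν / 2 * ‖gradL2 w‖ ^ 2) / 2 := by
  by_cases hν : ν = 0
  · simp [hν]
  · rw [gradL2_smul hΩ ((hz hν).add (hw hν)), gradL2_add hΩ (hz hν) (hw hν),
      gradL2_sub hΩ (hz hν) (hw hν)]
    have h := congrArg (ν / 2 * ·) (norm_midpoint_sq (gradL2 z) (gradL2 w))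
    linarith

end States

/-! ### Coercive quadratic forms of sums -/

section Coercive

variable {X Z S : Type*} [NormedAddCommGroup X] [NormedSpace ℝ X] [NormedAddCommGroup Z]
  [NormedSpace ℝ Z] [NormedAddCommGroup S] [NormedSpace ℝ S]

/-- As `A u = (A u - B z) + B z`, the form `κ‖A u - B z‖² + c‖z‖²` controls both `A u` and `z`. -/
theorem exists_coercive_sub (A : X →L[ℝ] S) (B : Z →L[ℝ] S) (hB : ∀ z, ‖B z‖ ≤ ‖z‖)
    {κ c c₀ : ℝ} (hκ : 0 < κ) (hc : 0 < c) (hc₀ : 0 < c₀) : ∃ t : ℝ, 0 < t ∧ ∀ (u : X) (z : Z),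
      c₀ * ‖u‖ ^ 2 ≤ ‖A u‖ ^ 2 → t * (‖u‖ ^ 2 + ‖z‖ ^ 2) ≤ κ * ‖A u - B z‖ ^ 2 + c * ‖z‖ ^ 2 := by
  set s := min κ (c / 2) with hs
  have hs0 : 0 < s := lt_min hκ (by positivity)
  refine ⟨min (s * c₀ / 2) (c / 2), by positivity, fun u z hu => ?_⟩
  have h1 : ‖A u‖ ≤ ‖A u - B z‖ + ‖z‖ := by
    have := norm_add_le (A u - B z) (B z)
    rw [sub_add_cancel] at this
    linarith [hB z]
  have h2 : ‖A u‖ ^ 2 ≤ 2 * (‖A u - B z‖ ^ 2 + ‖z‖ ^ 2) := by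
    have := pow_le_pow_left₀ (norm_nonneg _) h1 2
    nlinarith [sq_nonneg (‖A u - B z‖ - ‖z‖)]
  have h4 : s * ‖A u - B z‖ ^ 2 ≤ κ * ‖A u - B z‖ ^ 2 :=
    mul_le_mul_of_nonneg_right (min_le_left _ _) (sq_nonneg _)
  have h5 : s * ‖z‖ ^ 2 ≤ c / 2 * ‖z‖ ^ 2 :=
    mul_le_mul_of_nonneg_right (min_le_right _ _) (sq_nonneg _)
  have h6 : min (s * c₀ / 2) (c / 2) * ‖u‖ ^ 2 ≤ s * c₀ / 2 * ‖u‖ ^ 2 :=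
    mul_le_mul_of_nonneg_right (min_le_left _ _) (sq_nonneg _)
  have h7 : min (s * c₀ / 2) (c / 2) * ‖z‖ ^ 2 ≤ c / 2 * ‖z‖ ^ 2 :=
    mul_le_mul_of_nonneg_right (min_le_right _ _) (sq_nonneg _)
  have h8 := mul_le_mul_of_nonneg_left (hu.trans h2) hs0.le
  linarith

theorem exists_le_coercive_sub (A : X →L[ℝ] S) (B : Z →L[ℝ] S) (hB : ∀ z, ‖B z‖ ≤ ‖z‖)
    {κ c c₀ : ℝ} (hκ : 0 < κ) (hc : 0 < c) (hc₀ : 0 < c₀) (ℓ : X →L[ℝ] ℝ) (u₀ : X) :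
    ∃ b : ℝ, ∀ (u : X) (z : Z), c₀ * ‖u - u₀‖ ^ 2 ≤ ‖A (u - u₀)‖ ^ 2 →
      b ≤ κ * ‖A u - B z‖ ^ 2 + c * ‖z‖ ^ 2 - ℓ u := by
  obtain ⟨t, ht, h⟩ := exists_coercive_sub A B hB hκ hc hc₀
  refine ⟨- κ * ‖A u₀‖ ^ 2 - ‖ℓ‖ ^ 2 / (2 * t) - ℓ u₀, fun u z hu => ?_⟩
  have h1 := h (u - u₀) z hu
  have h2 : ‖A (u - u₀) - B z‖ ≤ ‖A u - B z‖ + ‖A u₀‖ := by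
    have e : A (u - u₀) - B z = (A u - B z) - A u₀ := by rw [map_sub]; abel
    rw [e]; exact norm_sub_le _ _
  have h3 : ‖A (u - u₀) - B z‖ ^ 2 ≤ 2 * (‖A u - B z‖ ^ 2 + ‖A u₀‖ ^ 2) := by
    have := pow_le_pow_left₀ (norm_nonneg _) h2 2
    nlinarith [sq_nonneg (‖A u - B z‖ - ‖A u₀‖)]
  have h4 := mul_le_mul_of_nonneg_left h3 hκ.le
  have h5 : ℓ u ≤ ‖ℓ‖ * ‖u - u₀‖ + ℓ u₀ := by
    have := (le_abs_self _).trans (ℓ.le_opNorm (u - u₀))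
    rw [map_sub] at this
    linarith
  -- the square `(t‖u - u₀‖ - ‖ℓ‖)² / (2t)` absorbs the linear term
  have h6 : ‖ℓ‖ * ‖u - u₀‖ ≤ t / 2 * ‖u - u₀‖ ^ 2 + ‖ℓ‖ ^ 2 / (2 * t) := by
    have e : t / 2 * ‖u - u₀‖ ^ 2 + ‖ℓ‖ ^ 2 / (2 * t) - ‖ℓ‖ * ‖u - u₀‖
        = (t * ‖u - u₀‖ - ‖ℓ‖) ^ 2 / (2 * t) := by field_simp; ring
    have : 0 ≤ (t * ‖u - u₀‖ - ‖ℓ‖) ^ 2 / (2 * t) := by positivity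
    linarith
  have h7 : 0 ≤ t * ‖z‖ ^ 2 := by positivity
  have h8 : 0 ≤ c * ‖z‖ ^ 2 := by positivity
  linarith

end Coercive

/-! ### Strong convexity, continuity and lower bound of the energy -/

namespace Material

variable (M : Material) {Ω : Set E3}

/-- If Korn's inequality holds for the first component, the elastic energy and the quadratic term of
the inelastic energy together control the norm. The factors `1 / 4` are those gained at a
midpoint. -/
theorem exists_quadratic_coercive {c₀ : ℝ} (hc₀ : 0 < c₀) : ∃ t : ℝ, 0 < t ∧
    ∀ y : H1 Ω E3 × L2 Ω DevT, c₀ * ‖y.1‖ ^ 2 ≤ ‖strainL y.1‖ ^ 2 →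
      t * (‖y.1‖ ^ 2 + ‖y.2‖ ^ 2) ≤ 1 / 4 * M.elasticPart y + M.c₂ / 4 * ‖y.2‖ ^ 2 := by
  obtain ⟨κ, hκ, h⟩ := M.exists_elasticPart_coercive (Ω := Ω)
  obtain ⟨t, ht, ht'⟩ := exists_coercive_sub (X := H1 Ω E3) (Z := L2 Ω DevT)
    (S := L2 Ω SymT) strainL embL norm_embL
    (κ := κ / 4) (c := M.c₂ / 4) (by positivity) (by linarith [M.c₂_pos]) hc₀
  refine ⟨t, ht, fun y hy => ?_⟩
  have h1 := ht' y.1 y.2 hy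
  have h2 := h y
  rw [elasticStrain_apply] at h2
  linarith

/-- The energy has a lower bound which does not depend on `ρ` and `ν`. -/
theorem exists_le_energy (ℓ : H1 Ω E3 →L[ℝ] ℝ) (zbar : L2 Ω DevT) (uDir : H1 Ω E3) {c₀ : ℝ}
    (hc₀ : 0 < c₀) : ∃ B : ℝ, ∀ ρ ν : ℝ, 0 ≤ ρ → 0 ≤ ν → ∀ y : H1 Ω E3 × L2 Ω DevT,
      c₀ * ‖y.1 - uDir‖ ^ 2 ≤ ‖strainL (y.1 - uDir)‖ ^ 2 → B ≤ M.energy ℓ zbar ρ ν y := by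
  obtain ⟨κ, hκ, h⟩ := M.exists_elasticPart_coercive (Ω := Ω)
  obtain ⟨b, hb⟩ := exists_le_coercive_sub (X := H1 Ω E3) (Z := L2 Ω DevT)
    (S := L2 Ω SymT) strainL embL norm_embL hκ M.c₂_pos hc₀
    ℓ uDir
  refine ⟨b, fun ρ ν hρ hν y hy => ?_⟩
  have h1 := hb y.1 y.2 hy
  have h2 := h y
  rw [elasticStrain_apply] at h2
  have h3 := M.intG_nonneg hρ y.2
  have h4 := M.dissipation_nonneg (y.2 - zbar)
  have h5 : 0 ≤ ν / 2 * ‖gradL2 y.2‖ ^ 2 := by positivity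
  simp only [energy]
  linarith

section FiniteMeasure

variable [IsFiniteMeasure ((volume : Measure E3).restrict Ω)]

/-- The energy is continuous for the strong convergence of states. -/
theorem tendsto_energy (ℓ : H1 Ω E3 →L[ℝ] ℝ) (zbar : L2 Ω DevT) {ρ : ℝ} (hρ : 0 ≤ ρ) {ν : ℝ}
    {ι : Type*} {l : Filter ι} {x : ι → H1 Ω E3 × L2 Ω DevT} {y : H1 Ω E3 × L2 Ω DevT}
    (h : TendstoState ν x l y) :
    Tendsto (fun i => M.energy ℓ zbar ρ ν (x i)) l (𝓝 (M.energy ℓ zbar ρ ν y)) := by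
  have h1 := (continuous_fst.tendsto y).comp h.1
  have h2 := (continuous_snd.tendsto y).comp h.1
  have h3 : Tendsto (fun i => ν / 2 * ‖gradL2 (x i).2‖ ^ 2) l (𝓝 (ν / 2 * ‖gradL2 y.2‖ ^ 2)) := by
    refine tendsto_mul_norm_sq fun h0 => h.2 ?_
    rintro rfl
    simp at h0
  refine (((M.continuous_elasticPart.tendsto y).comp h.1).add
    ((((M.continuous_intG hρ).tendsto _).comp h2).add (tendsto_mul_norm_sq fun _ => h2))).add h3
      |>.add (((ℓ.continuous.tendsto _).comp h1).neg.add
        ((M.continuous_dissipation.tendsto _).comp (h2.sub_const zbar)))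

/-- Strong convexity of the energy, with a modulus that does not depend on `ρ` and `ν`. -/
theorem exists_energy_midpoint (hΩ : IsOpen Ω) (ℓ : H1 Ω E3 →L[ℝ] ℝ) (zbar : L2 Ω DevT) {c₀ : ℝ}
    (hc₀ : 0 < c₀) : ∃ β : ℝ, 0 < β ∧ ∀ ρ ν : ℝ, 0 ≤ ρ → 0 ≤ ν →
    ∀ y w : H1 Ω E3 × L2 Ω DevT, MemSobolev ν y.2 → MemSobolev ν w.2 →
      c₀ * ‖(y - w).1‖ ^ 2 ≤ ‖strainL (y - w).1‖ ^ 2 →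
      M.energy ℓ zbar ρ ν ((1 / 2 : ℝ) • (y + w)) + β * stateNormSq ν (y - w)
        ≤ (M.energy ℓ zbar ρ ν y + M.energy ℓ zbar ρ ν w) / 2 := by
  obtain ⟨t, ht, hco⟩ := M.exists_quadratic_coercive (Ω := Ω) hc₀
  refine ⟨min t (1 / 8), by positivity, fun ρ ν hρ hν y w hy hw hK => ?_⟩
  have h1 := M.elasticPart_midpoint y w
  have h2 := norm_midpoint_sq y.2 w.2
  have h3 := M.intG_midpoint hρ y.2 w.2
  have h4 := M.dissipation_midpoint y.2 w.2 zbar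
  have h5 := grad_midpoint hΩ hy hw
  have h6 := hco (y - w) hK
  have h7 : ℓ ((1 / 2 : ℝ) • (y + w)).1 = (ℓ y.1 + ℓ w.1) / 2 := by
    rw [Prod.smul_fst, Prod.fst_add, map_smul, map_add, smul_eq_mul]; ring
  have h8 : min t (1 / 8) * (‖(y - w).1‖ ^ 2 + ‖(y - w).2‖ ^ 2)
      ≤ t * (‖(y - w).1‖ ^ 2 + ‖(y - w).2‖ ^ 2) :=
    mul_le_mul_of_nonneg_right (min_le_left _ _) (by positivity)
  have h9 : min t (1 / 8) * (ν * ‖gradL2 (y - w).2‖ ^ 2)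
      ≤ 1 / 8 * (ν * ‖gradL2 (y - w).2‖ ^ 2) :=
    mul_le_mul_of_nonneg_right (min_le_right _ _) (by positivity)
  have e : min t (1 / 8) * stateNormSq ν (y - w) =
      min t (1 / 8) * (‖(y - w).1‖ ^ 2 + ‖(y - w).2‖ ^ 2)
        + min t (1 / 8) * (ν * ‖gradL2 (y - w).2‖ ^ 2) := by rw [stateNormSq]; ring
  rw [e]
  simp only [energy]
  rw [h7]
  rw [Prod.smul_snd, Prod.snd_add]
  rw [Prod.snd_sub] at h6 h8 h9 ⊢
  have h10 : M.c₂ * ‖(1 / 2 : ℝ) • (y.2 + w.2)‖ ^ 2 + M.c₂ / 4 * ‖y.2 - w.2‖ ^ 2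
      = (M.c₂ * ‖y.2‖ ^ 2 + M.c₂ * ‖w.2‖ ^ 2) / 2 := by
    have h11 := congrArg (M.c₂ * ·) h2
    linarith
  linarith

theorem energy_anti (ℓ : H1 Ω E3 →L[ℝ] ℝ) (zbar : L2 Ω DevT) {σ ρ ν ν' : ℝ} (hσ : 0 < σ)
    (h : σ ≤ ρ) (hν : ν ≤ ν') (y : H1 Ω E3 × L2 Ω DevT) :
    M.energy ℓ zbar ρ ν y ≤ M.energy ℓ zbar σ ν' y := by
  have h1 := M.intG_anti hσ h y.2
  have h2 : ν / 2 * ‖gradL2 y.2‖ ^ 2 ≤ ν' / 2 * ‖gradL2 y.2‖ ^ 2 :=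
    mul_le_mul_of_nonneg_right (by linarith) (sq_nonneg _)
  simp only [energy]
  linarith

theorem energy_le_energy_zero (ℓ : H1 Ω E3 →L[ℝ] ℝ) (zbar : L2 Ω DevT) {ρ ν ν' : ℝ} (hρ : 0 ≤ ρ)
    (hν : ν ≤ ν') {y : H1 Ω E3 × L2 Ω DevT}
    (hy : ∀ᵐ x ∂((volume : Measure E3).restrict Ω), ‖y.2 x‖ ≤ M.c₃) :
    M.energy ℓ zbar ρ ν y ≤ M.energy ℓ zbar 0 ν' y := by
  have h1 := M.intG_le_intG_zero hρ hy
  have h2 : ν / 2 * ‖gradL2 y.2‖ ^ 2 ≤ ν' / 2 * ‖gradL2 y.2‖ ^ 2 :=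
    mul_le_mul_of_nonneg_right (by linarith) (sq_nonneg _)
  simp only [energy]
  linarith

end FiniteMeasure

end Material

/-! ### The incremental functional and the real-valued energy -/

namespace Material

variable (M : Material) {Ω : Set E3}

theorem lintegral_F_zero_eq_top {z : L2 Ω DevT}
    (hz : ¬ ∀ᵐ x ∂((volume : Measure E3).restrict Ω), ‖z x‖ ≤ M.c₃) :
    ∫⁻ x in Ω, M.F 0 (z x) = ⊤ := by
  classical
  have hm : Measurable fun r : ℝ => if r ≤ M.c₃ then
      ENNReal.ofReal (M.c₁ * r + M.c₂ * r ^ 2) else ⊤ := by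
    refine Measurable.ite (measurableSet_le measurable_id measurable_const) ?_ measurable_const
    fun_prop
  have hF : (fun x => M.F 0 (z x)) = fun x => (fun r : ℝ => if r ≤ M.c₃ then
      ENNReal.ofReal (M.c₁ * r + M.c₂ * r ^ 2) else ⊤) ‖z x‖ := by
    funext x
    simp only [F, if_true]
  have hmeas : AEMeasurable (fun x => M.F 0 (z x)) ((volume : Measure E3).restrict Ω) := by
    rw [hF]
    exact hm.comp_aemeasurable (Lp.aestronglyMeasurable z).norm.aemeasurable
  refine lintegral_eq_top_of_measure_eq_top_ne_zero hmeas fun h0 => hz ?_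
  rw [ae_iff]
  refine measure_mono_null (fun x hx => ?_) h0
  exact M.F_eq_top rfl hx

theorem incremental_eq_top (ℓ : H1 Ω E3 →L[ℝ] ℝ) (zbar : L2 Ω DevT) (ν : ℝ)
    {y : H1 Ω E3 × L2 Ω DevT}
    (hb : ¬ ∀ᵐ x ∂((volume : Measure E3).restrict Ω), ‖y.2 x‖ ≤ M.c₃) :
    M.incremental ℓ zbar 0 ν y = ⊤ := by
  rw [incremental, storedEnergy, inelasticEnergy, M.lintegral_F_zero_eq_top hb, top_add, add_top,
    EReal.coe_ennreal_top, EReal.top_add_coe]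

section FiniteMeasure

variable [IsFiniteMeasure ((volume : Measure E3).restrict Ω)]

theorem lintegral_F_eq {ρ : ℝ} (hρ : 0 ≤ ρ) {z : L2 Ω DevT}
    (hz : ρ = 0 → ∀ᵐ x ∂((volume : Measure E3).restrict Ω), ‖z x‖ ≤ M.c₃) :
    ∫⁻ x in Ω, M.F ρ (z x) = ENNReal.ofReal (M.intG ρ z + M.c₂ * ‖z‖ ^ 2) := by
  have h1 := M.integrable_G hρ z
  have h2 := (integrable_norm_sq z).const_mul M.c₂
  have h12 : Integrable (fun x => M.G ρ ‖z x‖ + M.c₂ * ‖z x‖ ^ 2)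
      ((volume : Measure E3).restrict Ω) := h1.add h2
  rw [intG, ← integral_norm_sq z, ← integral_const_mul, ← integral_add h1 h2,
    ofReal_integral_eq_lintegral_ofReal h12
      (Eventually.of_forall fun x => add_nonneg (M.G_nonneg hρ _)
        (mul_nonneg M.c₂_pos.le (sq_nonneg _)))]
  refine lintegral_congr_ae ?_
  have h3 : ∀ᵐ x ∂((volume : Measure E3).restrict Ω), ρ = 0 → ‖z x‖ ≤ M.c₃ := by
    by_cases h : ρ = 0
    · filter_upwards [hz h] with x hx _ using hx
    · exact Eventually.of_forall fun x h' => absurd h' h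
  filter_upwards [h3] with x hx using M.F_eq_ofReal (z x) hx

theorem incremental_eq_energy (hΩ : IsOpen Ω) (ℓ : H1 Ω E3 →L[ℝ] ℝ) (zbar : L2 Ω DevT) {ρ ν : ℝ}
    (hρ : 0 ≤ ρ) (hν : 0 ≤ ν) {y : H1 Ω E3 × L2 Ω DevT} (hy : MemSobolev ν y.2)
    (hb : ρ = 0 → ∀ᵐ x ∂((volume : Measure E3).restrict Ω), ‖y.2 x‖ ≤ M.c₃) :
    M.incremental ℓ zbar ρ ν y = (M.energy ℓ zbar ρ ν y : EReal) := by
  have h1 : ENNReal.ofReal (ν / 2) * gradEnergy y.2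
      = ENNReal.ofReal (ν / 2 * ‖gradL2 y.2‖ ^ 2) := by
    by_cases h : ν = 0
    · simp [h]
    · rw [gradEnergy_eq hΩ (hy h), ENNReal.ofReal_mul (by positivity)]
  have h2 : 0 ≤ M.intG ρ y.2 + M.c₂ * ‖y.2‖ ^ 2 :=
    add_nonneg (M.intG_nonneg hρ _) (mul_nonneg M.c₂_pos.le (sq_nonneg _))
  have h3 : 0 ≤ ν / 2 * ‖gradL2 y.2‖ ^ 2 := by positivity
  have h4 := M.elasticPart_nonneg y
  rw [incremental, storedEnergy, inelasticEnergy, M.lintegral_F_eq hρ hb, h1,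
    elasticEnergy_eq, ← ENNReal.ofReal_add h2 h3, ← ENNReal.ofReal_add h4 (by positivity),
    EReal.coe_ennreal_ofReal, max_eq_left (by positivity), ← EReal.coe_add]
  congr 1
  simp only [energy]
  ring

end FiniteMeasure

end Material

/-! ### Admissible states of finite energy -/

section Admissible

variable {Ω Γ : Set E3} {c₃ : ℝ} (A : SpaceApprox Ω Γ c₃) (uDir : H1 Ω E3)

/-- The admissible states at which the incremental functional is finite. -/
def finiteStates (ρ ν h : ℝ) : Set (H1 Ω E3 × L2 Ω DevT) :=
  {y | y ∈ admissible A uDir ν h ∧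
    (ρ = 0 → ∀ᵐ x ∂((volume : Measure E3).restrict Ω), ‖y.2 x‖ ≤ c₃)}

variable {A uDir}

theorem vanishesOn_sub_of_admissible {ν ν' h h' : ℝ} {y w : H1 Ω E3 × L2 Ω DevT}
    (hy : y ∈ admissible A uDir ν h) (hw : w ∈ admissible A uDir ν' h') :
    VanishesOn Ω Γ (y - w).1 := by
  have e : (y - w).1 = (y.1 - uDir) + (-1 : ℝ) • (w.1 - uDir) := by
    rw [Prod.fst_sub]; module
  rw [e]
  exact hy.2.1.add (hw.2.1.smul _)

theorem admissible_midpoint {ν h : ℝ} {y w : H1 Ω E3 × L2 Ω DevT}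
    (hy : y ∈ admissible A uDir ν h) (hw : w ∈ admissible A uDir ν h) :
    (1 / 2 : ℝ) • (y + w) ∈ admissible A uDir ν h := by
  have e : ((1 / 2 : ℝ) • (y + w)).1 - uDir
      = (1 / 2 : ℝ) • ((y.1 - uDir) + (w.1 - uDir)) := by
    rw [Prod.smul_fst, Prod.fst_add]; module
  refine ⟨hy.1.midpoint hw.1, ?_, fun hh => ⟨?_, ?_⟩⟩
  · rw [e]; exact (hy.2.1.add hw.2.1).smul _
  · rw [e]; exact Submodule.smul_mem _ _ (Submodule.add_mem _ (hy.2.2 hh).1 (hw.2.2 hh).1)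
  · exact Submodule.smul_mem _ _ (Submodule.add_mem _ (hy.2.2 hh).2 (hw.2.2 hh).2)

theorem finiteStates_midpoint {ρ ν h : ℝ} {y w : H1 Ω E3 × L2 Ω DevT}
    (hy : y ∈ finiteStates A uDir ρ ν h) (hw : w ∈ finiteStates A uDir ρ ν h) :
    (1 / 2 : ℝ) • (y + w) ∈ finiteStates A uDir ρ ν h := by
  refine ⟨admissible_midpoint hy.1 hw.1, fun h0 => ?_⟩
  filter_upwards [hy.2 h0, hw.2 h0, Lp.coeFn_smul (1 / 2 : ℝ) (y.2 + w.2),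
    Lp.coeFn_add y.2 w.2] with x h1 h2 h3 h4
  have e : ((1 / 2 : ℝ) • (y + w)).2 = (1 / 2 : ℝ) • (y.2 + w.2) := rfl
  rw [e, h3, Pi.smul_apply, h4, Pi.add_apply, norm_smul, Real.norm_of_nonneg (by norm_num)]
  linarith [norm_add_le (y.2 x) (w.2 x)]

/-- The state `(uDir, 0)` has finite energy for all parameters. -/
theorem zero_mem_finiteStates (hc₃ : 0 ≤ c₃) (ρ ν h : ℝ) :
    ((uDir, 0) : H1 Ω E3 × L2 Ω DevT) ∈ finiteStates A uDir ρ ν h := by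
  refine ⟨⟨fun _ => isH1_zero, ?_, fun _ => ⟨?_, Submodule.zero_mem _⟩⟩, fun _ => ?_⟩
  · rw [sub_self]; exact vanishesOn_zero
  · rw [sub_self]; exact Submodule.zero_mem _
  · filter_upwards [Lp.coeFn_zero DevT 2 ((volume : Measure E3).restrict Ω)] with x hx
    rw [hx, Pi.zero_apply, norm_zero]; exact hc₃

/-- The admissible set is closed, as the boundary condition and the discrete spaces are. -/
theorem mem_admissible_of_tendsto {ν h : ℝ} (hh : 0 ≤ h) {x : ℕ → H1 Ω E3 × L2 Ω DevT}
    {y : H1 Ω E3 × L2 Ω DevT} (hx : ∀ n, x n ∈ admissible A uDir ν h) (hy : MemSobolev ν y.2)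
    (hxy : TendstoState ν x atTop y) : y ∈ admissible A uDir ν h := by
  have h1 : Tendsto (fun n => (x n).1 - uDir) atTop (𝓝 (y.1 - uDir)) :=
    ((continuous_fst.tendsto y).comp hxy.1).sub_const _
  have h2 : Tendsto (fun n => (x n).2) atTop (𝓝 y.2) := (continuous_snd.tendsto y).comp hxy.1
  refine ⟨hy, isClosed_vanishesOn.mem_of_tendsto h1 (Eventually.of_forall fun n => (hx n).2.1),
    fun h0 => ?_⟩
  have hpos : 0 < h := lt_of_le_of_ne hh (Ne.symm h0)
  exact ⟨(A.isClosed_U h hpos).mem_of_tendsto h1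
      (Eventually.of_forall fun n => ((hx n).2.2 h0).1),
    (A.isClosed_Z h hpos).mem_of_tendsto h2 (Eventually.of_forall fun n => ((hx n).2.2 h0).2)⟩

end Admissible

/-- Since `(uDir, 0)` is admissible and has finite energy, minimizing the incremental functional
means minimizing the real-valued energy over the admissible states of finite energy. -/
theorem isMinimizer_iff {Ω Γ : Set E3} [IsFiniteMeasure ((volume : Measure E3).restrict Ω)]
    (hΩ : IsOpen Ω) (M : Material) (A : SpaceApprox Ω Γ M.c₃) (uDir : H1 Ω E3)
    (ℓ : H1 Ω E3 →L[ℝ] ℝ) (zbar : L2 Ω DevT) {ρ ν : ℝ} (hρ : 0 ≤ ρ) (hν : 0 ≤ ν) (h : ℝ)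
    (y : H1 Ω E3 × L2 Ω DevT) :
    IsMinimizer M A uDir ℓ zbar ρ ν h y ↔ y ∈ finiteStates A uDir ρ ν h ∧
      ∀ w ∈ finiteStates A uDir ρ ν h, M.energy ℓ zbar ρ ν y ≤ M.energy ℓ zbar ρ ν w := by
  have hfin : ∀ w ∈ finiteStates A uDir ρ ν h,
      M.incremental ℓ zbar ρ ν w = (M.energy ℓ zbar ρ ν w : EReal) := fun w hw =>
    M.incremental_eq_energy hΩ ℓ zbar hρ hν hw.1.1 hw.2
  have htop : ∀ w ∈ admissible A uDir ν h, w ∉ finiteStates A uDir ρ ν h →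
      M.incremental ℓ zbar ρ ν w = ⊤ := by
    intro w hw hw'
    have h1 : ¬ (ρ = 0 → ∀ᵐ x ∂((volume : Measure E3).restrict Ω), ‖w.2 x‖ ≤ M.c₃) :=
      fun h2 => hw' ⟨hw, h2⟩
    rw [Classical.not_imp] at h1
    rw [h1.1]
    exact M.incremental_eq_top ℓ zbar ν h1.2
  constructor
  · rintro ⟨hy, hmin⟩
    have hy' : y ∈ finiteStates A uDir ρ ν h := by
      by_contra hcon
      have h0 := zero_mem_finiteStates (A := A) (uDir := uDir) M.c₃_pos.le ρ ν h
      have h1 := hmin _ h0.1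
      rw [htop y hy hcon, hfin _ h0, top_le_iff] at h1
      exact EReal.coe_ne_top _ h1
    refine ⟨hy', fun w hw => ?_⟩
    have h1 := hmin w hw.1
    rw [hfin y hy', hfin w hw] at h1
    exact EReal.coe_le_coe_iff.1 h1
  · rintro ⟨hy, hmin⟩
    refine ⟨hy.1, fun w hw => ?_⟩
    by_cases hw' : w ∈ finiteStates A uDir ρ ν h
    · rw [hfin y hy, hfin w hw']
      exact EReal.coe_le_coe_iff.2 (hmin w hw')
    · rw [htop w hw hw']
      exact le_top

/-! ### Existence and uniqueness of minimizers -/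

/-- Almost minimizers `x n` of an increasing sequence of uniformly strongly convex functionals form
a Cauchy sequence as soon as their values converge: for `n ≤ m`, the midpoint of `x n` and `x m`
competes with `x n` for the functional `J n ≤ J m`. -/
theorem cauchy_of_midpoint {E : Type*} [AddCommGroup E] [Module ℝ E] {K : Set E} {N : E → ℝ}
    {β : ℝ} (hβ : 0 < β) (hN : ∀ a ∈ K, ∀ b ∈ K, N (a - b) = N (b - a)) {J : ℕ → E → ℝ}
    {x : ℕ → E} {δ : ℕ → ℝ} {c : ℝ} (hx : ∀ n, x n ∈ K)
    (hK : ∀ a ∈ K, ∀ b ∈ K, (1 / 2 : ℝ) • (a + b) ∈ K)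
    (hmid : ∀ n, ∀ a ∈ K, ∀ b ∈ K,
      J n ((1 / 2 : ℝ) • (a + b)) + β * N (a - b) ≤ (J n a + J n b) / 2)
    (hmono : ∀ n m, n ≤ m → ∀ a ∈ K, J n a ≤ J m a)
    (hmin : ∀ n, ∀ a ∈ K, J n (x n) ≤ J n a + δ n) (hδ : Tendsto δ atTop (𝓝 0))
    (hc : Tendsto (fun n => J n (x n)) atTop (𝓝 c)) :
    ∀ ε > 0, ∃ n₀, ∀ n ≥ n₀, ∀ m ≥ n₀, N (x n - x m) < ε := by
  intro ε hε
  have hη : 0 < β * ε / 3 := by positivity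
  obtain ⟨n₁, h₁⟩ := Metric.tendsto_atTop.1 hδ _ hη
  obtain ⟨n₂, h₂⟩ := Metric.tendsto_atTop.1 hc _ hη
  have key : ∀ n ≥ max n₁ n₂, ∀ m ≥ n, N (x n - x m) < ε := by
    intro n hn m hm
    have a1 := (abs_lt.1 (by simpa [Real.dist_eq] using h₁ n ((le_max_left _ _).trans hn))).2
    have a2 := abs_lt.1 (h₂ n ((le_max_right _ _).trans hn))
    have a3 := abs_lt.1 (h₂ m (((le_max_right _ _).trans hn).trans hm))
    have b1 := hmid n _ (hx n) _ (hx m)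
    have b2 := hmin n _ (hK _ (hx n) _ (hx m))
    have b3 := hmono n m hm _ (hx m)
    have : β * N (x n - x m) < β * ε := by linarith [a2.1, a3.2]
    exact lt_of_mul_lt_mul_left this hβ.le
  refine ⟨max n₁ n₂, fun n hn m hm => ?_⟩
  rcases le_total n m with h | h
  · exact key n hn m h
  · rw [hN _ (hx n) _ (hx m)]; exact key m hm n h

theorem norm_add_sq_le {X : Type*} [NormedAddCommGroup X] (a b : X) :
    ‖a + b‖ ^ 2 ≤ 2 * (‖a‖ ^ 2 + ‖b‖ ^ 2) := by
  have := pow_le_pow_left₀ (norm_nonneg _) (norm_add_le a b) 2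
  nlinarith [sq_nonneg (‖a‖ - ‖b‖)]

section

variable {Ω : Set E3} {W V : Type*} [NormedAddCommGroup W] [NormedSpace ℝ W]
  [NormedAddCommGroup V] [NormedSpace ℝ V] [CompleteSpace V]

theorem stateNormSq_sub_comm (hΩ : IsOpen Ω) {ν : ℝ} {y w : H1 Ω W × L2 Ω V}
    (hy : MemSobolev ν y.2) (hw : MemSobolev ν w.2) :
    stateNormSq ν (y - w) = stateNormSq ν (w - y) := by
  have h : ν * ‖gradL2 (y - w).2‖ ^ 2 = ν * ‖gradL2 (w - y).2‖ ^ 2 := by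
    by_cases h0 : ν = 0
    · simp [h0]
    · rw [Prod.snd_sub, Prod.snd_sub, gradL2_sub hΩ (hy h0) (hw h0),
        gradL2_sub hΩ (hw h0) (hy h0), norm_sub_rev]
  rw [stateNormSq, stateNormSq, h, Prod.fst_sub, Prod.fst_sub, norm_sub_rev y.1, Prod.snd_sub,
    Prod.snd_sub, norm_sub_rev y.2]

theorem stateNormSq_add_le (hΩ : IsOpen Ω) {ν : ℝ} (hν : 0 ≤ ν) {y w : H1 Ω W × L2 Ω V}
    (hy : MemSobolev ν y.2) (hw : MemSobolev ν w.2) :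
    stateNormSq ν (y + w) ≤ 2 * (stateNormSq ν y + stateNormSq ν w) := by
  have h : ν * ‖gradL2 (y + w).2‖ ^ 2
      ≤ 2 * (ν * ‖gradL2 y.2‖ ^ 2 + ν * ‖gradL2 w.2‖ ^ 2) := by
    by_cases h0 : ν = 0
    · simp [h0]
    · rw [Prod.snd_add, gradL2_add hΩ (hy h0) (hw h0)]
      have := mul_le_mul_of_nonneg_left (norm_add_sq_le (gradL2 y.2) (gradL2 w.2)) hν
      linarith
  have h1 : ‖(y + w).1‖ ^ 2 ≤ 2 * (‖y.1‖ ^ 2 + ‖w.1‖ ^ 2) := norm_add_sq_le y.1 w.1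
  have h2 : ‖(y + w).2‖ ^ 2 ≤ 2 * (‖y.2‖ ^ 2 + ‖w.2‖ ^ 2) := norm_add_sq_le y.2 w.2
  simp only [stateNormSq]
  linarith

end

theorem KornInequality.exists_vanishing {Ω Γ : Set E3} (hK : KornInequality Ω Γ) :
    ∃ c₀ : ℝ, 0 < c₀ ∧ ∀ u : H1 Ω E3, VanishesOn Ω Γ u → c₀ * ‖u‖ ^ 2 ≤ ‖strainL u‖ ^ 2 := by
  obtain ⟨c₀, hc₀, h⟩ := hK
  refine ⟨c₀, hc₀, fun u hu => ?_⟩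
  have h1 := h u 0 hu
  rw [norm_zero] at h1
  have e : strainL u = strain u := rfl
  rw [e]
  linarith

section Existence

variable {Ω Γ : Set E3} {M : Material}
  {A : SpaceApprox Ω Γ M.c₃} {uDir : H1 Ω E3} {ℓ : H1 Ω E3 →L[ℝ] ℝ} {zbar : L2 Ω DevT}
  {β B : ℝ}

/-- The energy is strongly convex on the admissible states, with modulus `β`. -/
def EnergyConvex (M : Material) (A : SpaceApprox Ω Γ M.c₃) (uDir : H1 Ω E3)
    (ℓ : H1 Ω E3 →L[ℝ] ℝ) (zbar : L2 Ω DevT) (β : ℝ) : Prop :=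
  0 < β ∧ ∀ ρ ν h : ℝ, 0 ≤ ρ → 0 ≤ ν →
    ∀ y ∈ admissible A uDir ν h, ∀ w ∈ admissible A uDir ν h,
      M.energy ℓ zbar ρ ν ((1 / 2 : ℝ) • (y + w)) + β * stateNormSq ν (y - w)
        ≤ (M.energy ℓ zbar ρ ν y + M.energy ℓ zbar ρ ν w) / 2

/-- `B` is a lower bound of the energy on the admissible states. -/
def EnergyBound (M : Material) (A : SpaceApprox Ω Γ M.c₃) (uDir : H1 Ω E3)
    (ℓ : H1 Ω E3 →L[ℝ] ℝ) (zbar : L2 Ω DevT) (B : ℝ) : Prop :=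
  ∀ ρ ν h : ℝ, 0 ≤ ρ → 0 ≤ ν → ∀ y ∈ admissible A uDir ν h, B ≤ M.energy ℓ zbar ρ ν y

theorem exists_energyBound (hK : KornInequality Ω Γ) (A : SpaceApprox Ω Γ M.c₃)
    (uDir : H1 Ω E3) (ℓ : H1 Ω E3 →L[ℝ] ℝ) (zbar : L2 Ω DevT) :
    ∃ B, EnergyBound M A uDir ℓ zbar B := by
  obtain ⟨c₀, hc₀, h⟩ := hK.exists_vanishing
  obtain ⟨B, hB⟩ := M.exists_le_energy ℓ zbar uDir hc₀
  exact ⟨B, fun ρ ν h' hρ hν y hy => hB ρ ν hρ hν y (h _ hy.2.1)⟩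

/-- The distance of a competitor to the minimizer is controlled by the difference of their
energies. -/
theorem stateNormSq_sub_le_of_min (hconv : EnergyConvex M A uDir ℓ zbar β) {ρ ν h : ℝ}
    (hρ : 0 ≤ ρ) (hν : 0 ≤ ν) {y w : H1 Ω E3 × L2 Ω DevT} (hy : y ∈ finiteStates A uDir ρ ν h)
    (hmin : ∀ w ∈ finiteStates A uDir ρ ν h, M.energy ℓ zbar ρ ν y ≤ M.energy ℓ zbar ρ ν w)
    (hw : w ∈ finiteStates A uDir ρ ν h) :
    β * stateNormSq ν (y - w) ≤ (M.energy ℓ zbar ρ ν w - M.energy ℓ zbar ρ ν y) / 2 := by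
  have h1 := hconv.2 ρ ν h hρ hν y hy.1 w hw.1
  have h2 := hmin _ (finiteStates_midpoint hy hw)
  linarith

variable [IsFiniteMeasure ((volume : Measure E3).restrict Ω)]

theorem exists_energyConvex (hΩ : IsOpen Ω) (hK : KornInequality Ω Γ) (A : SpaceApprox Ω Γ M.c₃)
    (uDir : H1 Ω E3) (ℓ : H1 Ω E3 →L[ℝ] ℝ) (zbar : L2 Ω DevT) :
    ∃ β, EnergyConvex M A uDir ℓ zbar β := by
  obtain ⟨c₀, hc₀, h⟩ := hK.exists_vanishing
  obtain ⟨β, hβ, hβ'⟩ := M.exists_energy_midpoint hΩ ℓ zbar hc₀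
  exact ⟨β, hβ, fun ρ ν h' hρ hν y hy w hw => hβ' ρ ν hρ hν y w hy.1 hw.1
    (h _ (vanishesOn_sub_of_admissible hy hw))⟩

/-- Without the constraint `|z| ≤ c₃`, the energy attains its infimum: a minimizing sequence is a
Cauchy sequence by strong convexity. -/
theorem exists_min_admissible (hΩ : IsOpen Ω) (hconv : EnergyConvex M A uDir ℓ zbar β)
    (hB : EnergyBound M A uDir ℓ zbar B) {ρ ν h : ℝ} (hρ : 0 ≤ ρ) (hν : 0 ≤ ν) (hh : 0 ≤ h) :
    ∃ y ∈ admissible A uDir ν h, ∀ w ∈ admissible A uDir ν h,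
      M.energy ℓ zbar ρ ν y ≤ M.energy ℓ zbar ρ ν w := by
  set S := (M.energy ℓ zbar ρ ν) '' (admissible A uDir ν h) with hS
  have hne : S.Nonempty :=
    ⟨_, _, (zero_mem_finiteStates (A := A) (uDir := uDir) M.c₃_pos.le ρ ν h).1, rfl⟩
  have hbdd : BddBelow S := ⟨B, by rintro _ ⟨y, hy, rfl⟩; exact hB ρ ν h hρ hν y hy⟩
  have hδ : Tendsto (fun n : ℕ => 1 / ((n : ℝ) + 1)) atTop (𝓝 0) :=
    tendsto_one_div_add_atTop_nhds_zero_nat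
  have hx : ∀ n : ℕ, ∃ x ∈ admissible A uDir ν h,
      M.energy ℓ zbar ρ ν x < sInf S + 1 / ((n : ℝ) + 1) := fun n => by
    obtain ⟨_, ⟨x, hx, rfl⟩, hlt⟩ := exists_lt_of_csInf_lt hne
      (lt_add_of_pos_right (sInf S) (Nat.one_div_pos_of_nat (n := n)))
    exact ⟨x, hx, hlt⟩
  choose x hxK hxlt using hx
  have hinf : ∀ w ∈ admissible A uDir ν h, sInf S ≤ M.energy ℓ zbar ρ ν w := fun w hw =>
    csInf_le hbdd ⟨w, hw, rfl⟩
  have hlim : Tendsto (fun n => M.energy ℓ zbar ρ ν (x n)) atTop (𝓝 (sInf S)) := by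
    refine tendsto_of_tendsto_of_tendsto_of_le_of_le tendsto_const_nhds
      (h := fun n : ℕ => sInf S + 1 / ((n : ℝ) + 1)) ?_ (fun n => hinf _ (hxK n))
      fun n => (hxlt n).le
    simpa using hδ.const_add (sInf S)
  have hcau := cauchy_of_midpoint (K := admissible A uDir ν h) (N := stateNormSq ν)
    (J := fun _ => M.energy ℓ zbar ρ ν) hconv.1
    (fun a ha b hb => stateNormSq_sub_comm hΩ ha.1 hb.1) hxK
    (fun a ha b hb => admissible_midpoint ha hb)
    (fun _ a ha b hb => hconv.2 ρ ν h hρ hν a ha b hb) (fun _ _ _ _ _ => le_rfl)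
    (fun n a ha => by linarith [hxlt n, hinf a ha]) hδ hlim
  obtain ⟨y, hy, hxy⟩ := exists_tendstoState_of_cauchy hΩ hν (fun n => (hxK n).1) hcau
  refine ⟨y, mem_admissible_of_tendsto hh hxK hy hxy, fun w hw => ?_⟩
  rw [tendsto_nhds_unique (M.tendsto_energy ℓ zbar hρ hxy) hlim]
  exact hinf w hw

theorem integrable_φ (z : L2 Ω DevT) :
    Integrable (fun x => M.φ ‖z x‖) ((volume : Measure E3).restrict Ω) := by
  obtain ⟨K, hK⟩ := M.exists_lipschitzWith_φ
  have h : LipschitzWith (K * 1) fun a : DevT => M.φ ‖a‖ := hK.comp lipschitzWith_one_norm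
  exact integrable_lipschitz_comp h (by rw [norm_zero, M.φ_eq_zero M.c₃_pos.le]) z

/-- The energy density at `ρ = 0`, together with the penalty, exceeds the one at `ρ` at most by
a multiple of `ρ`. -/
theorem intG_zero_le {ρ : ℝ} (hρ : 0 < ρ) (z : L2 Ω DevT) :
    M.intG 0 z + (∫ x in Ω, M.φ ‖z x‖) / ρ
      ≤ M.intG ρ z + ρ * (M.c₁ * ((volume : Measure E3).restrict Ω).real Set.univ) := by
  have h0 := M.integrable_G le_rfl z
  have h1 := M.integrable_G hρ.le z
  have h2 := (integrable_φ (M := M) z).div_const ρ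
  have hc : Integrable (fun _ : E3 => M.c₁ * ρ) ((volume : Measure E3).restrict Ω) :=
    integrable_const _
  have h3 : ∫ x in Ω, (M.G 0 ‖z x‖ + M.φ ‖z x‖ / ρ) ≤ ∫ x in Ω, (M.G ρ ‖z x‖ + M.c₁ * ρ) :=
    integral_mono (h0.add h2) (h1.add hc) fun x => by
      have := M.G_zero_sub_le (ρ := ρ) (norm_nonneg (z x))
      simp only
      linarith
  rw [integral_add h0 h2, integral_add h1 hc, integral_div, integral_const, smul_eq_mul] at h3
  simp only [Material.intG]
  linarith

/-- For `ρ = 0`, a minimizer is obtained as the limit of the minimizers `x n` for `ρ = 1 / (n + 1)`.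
Their energies increase with `n` and stay below the infimum for `ρ = 0`, so they converge, and
strong convexity makes `x n` a Cauchy sequence. Boundedness of the penalty `(n + 1) ∫ φ(|z|)` at the
limit forces `|z| ≤ c₃`. The last clause says that the minimal values for `ρ > 0` come arbitrarily
close to the one for `ρ = 0`. -/
theorem exists_min_limit (hΩ : IsOpen Ω) (hconv : EnergyConvex M A uDir ℓ zbar β)
    (hB : EnergyBound M A uDir ℓ zbar B) {ν h : ℝ} (hν : 0 ≤ ν) (hh : 0 ≤ h) :
    ∃ y ∈ finiteStates A uDir 0 ν h, ∀ ε > 0, ∃ σ > 0, ∀ w ∈ admissible A uDir ν h,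
      M.energy ℓ zbar 0 ν y - ε ≤ M.energy ℓ zbar σ ν w := by
  set r : ℕ → ℝ := fun n => 1 / ((n : ℝ) + 1) with hr
  have hr0 : ∀ n, 0 < r n := fun n => Nat.one_div_pos_of_nat
  have hranti : ∀ n m, n ≤ m → r m ≤ r n := fun n m hnm => Nat.one_div_le_one_div hnm
  have hrlim : Tendsto r atTop (𝓝 0) := tendsto_one_div_add_atTop_nhds_zero_nat
  choose x hxK hxmin using fun n => exists_min_admissible hΩ hconv hB (hr0 n).le hν hh
  have hmono : ∀ n m, n ≤ m → ∀ a, M.energy ℓ zbar (r n) ν a ≤ M.energy ℓ zbar (r m) ν a :=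
    fun n m hnm a => M.energy_anti ℓ zbar (hr0 m) (hranti n m hnm) le_rfl a
  have hvmono : Monotone fun n => M.energy ℓ zbar (r n) ν (x n) := fun n m hnm =>
    (hxmin n _ (hxK m)).trans (hmono n m hnm _)
  have h0 := zero_mem_finiteStates (A := A) (uDir := uDir) M.c₃_pos.le 0 ν h
  have hvbdd : BddAbove (Set.range fun n => M.energy ℓ zbar (r n) ν (x n)) := by
    refine ⟨M.energy ℓ zbar 0 ν (uDir, 0), ?_⟩
    rintro _ ⟨n, rfl⟩
    exact (hxmin n _ h0.1).trans (M.energy_le_energy_zero ℓ zbar (hr0 n).le le_rfl (h0.2 rfl))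
  have hlim := tendsto_atTop_ciSup hvmono hvbdd
  set c := ⨆ n, M.energy ℓ zbar (r n) ν (x n) with hc
  have hle : ∀ n, M.energy ℓ zbar (r n) ν (x n) ≤ c := fun n => le_ciSup hvbdd n
  have hcau := cauchy_of_midpoint (K := admissible A uDir ν h) (N := stateNormSq ν)
    (J := fun n => M.energy ℓ zbar (r n) ν) (δ := fun _ => 0) hconv.1
    (fun a ha b hb => stateNormSq_sub_comm hΩ ha.1 hb.1) hxK
    (fun a ha b hb => admissible_midpoint ha hb)
    (fun n a ha b hb => hconv.2 (r n) ν h (hr0 n).le hν a ha b hb)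
    (fun n m hnm a _ => hmono n m hnm a)
    (fun n a ha => by simpa using hxmin n a ha) tendsto_const_nhds hlim
  obtain ⟨y, hy, hxy⟩ := exists_tendstoState_of_cauchy hΩ hν (fun n => (hxK n).1) hcau
  have hyadm := mem_admissible_of_tendsto hh hxK hy hxy
  have hyle : ∀ n, M.energy ℓ zbar (r n) ν y ≤ c := fun n => by
    refine le_of_tendsto (M.tendsto_energy ℓ zbar (hr0 n).le hxy) ?_
    filter_upwards [eventually_ge_atTop n] with m hm
    exact (hmono n m hm _).trans (hle m)
  -- `P / r n` is the penalty at the limit; its boundedness as `r n → 0` forces `P = 0`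
  set P := ∫ x in Ω, M.φ ‖y.2 x‖ with hP
  set m₁ := M.c₁ * ((volume : Measure E3).restrict Ω).real Set.univ with hm₁
  have hP0 : 0 ≤ P := integral_nonneg fun x => M.φ_nonneg _
  have hmain : ∀ n, M.energy ℓ zbar 0 ν y + P / r n ≤ c + r n * m₁ := fun n => by
    have h1 := hyle n
    have h2 := intG_zero_le (M := M) (hr0 n) y.2
    simp only [Material.energy] at h1 ⊢
    linarith
  have hPzero : P = 0 := by
    refine le_antisymm ?_ hP0
    have h1 : ∀ n, P ≤ r n * (c + r n * m₁ - M.energy ℓ zbar 0 ν y) := fun n => by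
      have h2 := hmain n
      have h3 : P / r n ≤ c + r n * m₁ - M.energy ℓ zbar 0 ν y := by linarith
      rwa [div_le_iff₀' (hr0 n)] at h3
    have h2 : Tendsto (fun n => r n * (c + r n * m₁ - M.energy ℓ zbar 0 ν y)) atTop (𝓝 0) := by
      have := hrlim.mul (((hrlim.mul_const m₁).const_add c).sub_const (M.energy ℓ zbar 0 ν y))
      simpa using this
    exact ge_of_tendsto h2 (Eventually.of_forall h1)
  have hbound : ∀ᵐ x ∂((volume : Measure E3).restrict Ω), ‖y.2 x‖ ≤ M.c₃ := by
    have h1 := (integral_eq_zero_iff_of_nonneg (fun x => M.φ_nonneg _)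
      (integrable_φ (M := M) y.2)).1 hPzero
    filter_upwards [h1] with x hx using (M.φ_eq_zero_iff _).1 hx
  have hyc : M.energy ℓ zbar 0 ν y ≤ c := by
    have h1 : Tendsto (fun n => c + r n * m₁) atTop (𝓝 c) := by
      simpa using (hrlim.mul_const m₁).const_add c
    refine ge_of_tendsto h1 (Eventually.of_forall fun n => ?_)
    have h2 := hmain n
    rw [hPzero, zero_div, add_zero] at h2
    exact h2
  refine ⟨y, ⟨hyadm, fun _ => hbound⟩, fun ε hε => ?_⟩
  obtain ⟨n, hn⟩ := (hlim.eventually_const_lt (sub_lt_self c hε)).exists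
  exact ⟨r n, hr0 n, fun w hw => by linarith [hxmin n w hw]⟩

theorem exists_min_finiteStates (hΩ : IsOpen Ω) (hconv : EnergyConvex M A uDir ℓ zbar β)
    (hB : EnergyBound M A uDir ℓ zbar B) {ρ ν h : ℝ} (hρ : 0 ≤ ρ) (hν : 0 ≤ ν) (hh : 0 ≤ h) :
    ∃ y ∈ finiteStates A uDir ρ ν h, ∀ w ∈ finiteStates A uDir ρ ν h,
      M.energy ℓ zbar ρ ν y ≤ M.energy ℓ zbar ρ ν w := by
  rcases hρ.eq_or_lt with rfl | hpos
  · obtain ⟨y, hy, hmin⟩ := exists_min_limit hΩ hconv hB hν hh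
    refine ⟨y, hy, fun w hw => le_of_forall_pos_le_add fun ε hε => ?_⟩
    obtain ⟨σ, hσ, h1⟩ := hmin ε hε
    have h2 := h1 w hw.1
    have h3 := M.energy_le_energy_zero ℓ zbar hσ.le (le_refl ν) (hw.2 rfl)
    linarith
  · obtain ⟨y, hy, hmin⟩ := exists_min_admissible hΩ hconv hB hρ hν hh
    exact ⟨y, ⟨hy, fun h0 => absurd h0 hpos.ne'⟩, fun w hw => hmin w hw.1⟩

theorem existsUnique_isMinimizer (hΩ : IsOpen Ω) (hconv : EnergyConvex M A uDir ℓ zbar β)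
    (hB : EnergyBound M A uDir ℓ zbar B) {ρ ν h : ℝ} (hρ : 0 ≤ ρ) (hν : 0 ≤ ν) (hh : 0 ≤ h) :
    ∃! y : H1 Ω E3 × L2 Ω DevT, IsMinimizer M A uDir ℓ zbar ρ ν h y := by
  simp only [isMinimizer_iff hΩ M A uDir ℓ zbar hρ hν h]
  obtain ⟨y, hy, hmin⟩ := exists_min_finiteStates hΩ hconv hB hρ hν hh
  refine ⟨y, ⟨hy, hmin⟩, fun w hw => ?_⟩
  have h1 := stateNormSq_sub_le_of_min hconv hρ hν hw.1 hw.2 hy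
  have h2 := hmin w hw.1
  have h3 : β * ‖w - y‖ ^ 2 ≤ β * stateNormSq ν (w - y) :=
    mul_le_mul_of_nonneg_left (norm_sq_le_stateNormSq hν _) hconv.1.le
  have h4 : β * ‖w - y‖ ^ 2 ≤ 0 := by linarith
  have h5 : ‖w - y‖ ^ 2 ≤ 0 := by
    by_contra hcon
    have := mul_pos hconv.1 (not_le.1 hcon)
    linarith
  exact sub_eq_zero.1 (norm_eq_zero.1 (pow_eq_zero_iff two_ne_zero |>.1
    (le_antisymm h5 (sq_nonneg _))))

end Existence

/-! ### Convergence of minimizers -/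

namespace ConstOrToZero

variable {a : ℕ → ℝ} {b : ℝ}

theorem le (h : ConstOrToZero a b) (k : ℕ) : b ≤ a k := by
  rcases h.2.2 with h1 | ⟨h1, _⟩
  · rw [h1 k]
  · rw [h1]; exact h.1 k

theorem eq_of_ne_zero (h : ConstOrToZero a b) (hb : b ≠ 0) (k : ℕ) : a k = b := by
  rcases h.2.2 with h1 | ⟨h1, _⟩
  · exact h1 k
  · exact absurd h1 hb

theorem tendsto (h : ConstOrToZero a b) : Tendsto a atTop (𝓝 b) := by
  rcases h.2.2 with h1 | ⟨h1, h2⟩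
  · rw [funext h1]; exact tendsto_const_nhds
  · rw [h1]; exact h2

end ConstOrToZero

section

variable {Ω : Set E3} {V : Type*} [NormedAddCommGroup V] [NormedSpace ℝ V]

theorem sobolevNormSq_eq [CompleteSpace V] (hΩ : IsOpen Ω) {ν : ℝ} {z : L2 Ω V}
    (hz : MemSobolev ν z) : sobolevNormSq ν z =
      ENNReal.ofReal (‖z‖ ^ 2 + if ν = 0 then 0 else ‖gradL2 z‖ ^ 2) := by
  rw [sobolevNormSq]
  split_ifs with h
  · simp
  · rw [gradEnergy_eq hΩ (hz h), ENNReal.ofReal_add (by positivity) (by positivity)]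

theorem mul_grad_le (ν : ℝ) (hν : 0 ≤ ν) (z : L2 Ω V) :
    ‖z‖ ^ 2 + ν * ‖gradL2 z‖ ^ 2
      ≤ (1 + ν) * (‖z‖ ^ 2 + if ν = 0 then 0 else ‖gradL2 z‖ ^ 2) := by
  split_ifs with h
  · simp [h]
  · nlinarith [sq_nonneg ‖gradL2 z‖, mul_nonneg hν (sq_nonneg ‖z‖)]

end

section Admissible

variable {Ω Γ : Set E3} {c₃ : ℝ} {A : SpaceApprox Ω Γ c₃} {uDir : H1 Ω E3}

/-- The admissible sets are contained in the one for the limit parameters. -/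
theorem admissible_subset {νs hs : ℕ → ℝ} {ν h : ℝ} (hν : ConstOrToZero νs ν)
    (hh : ConstOrToZero hs h) (k : ℕ) :
    admissible A uDir (νs k) (hs k) ⊆ admissible A uDir ν h := by
  rintro y ⟨h1, h2, h3⟩
  refine ⟨fun h0 => h1 ?_, h2, fun h0 => ?_⟩
  · rwa [hν.eq_of_ne_zero h0 k]
  · have e := hh.eq_of_ne_zero h0 k
    rw [e] at h3
    exact h3 h0

/-- Without space discretization, every state of finite energy is the limit of states `x n`, each of
which is admissible, whatever `ν`, for all sufficiently small discretization parameters. This holds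
because the discrete spaces increase as the discretization parameter decreases. -/
theorem exists_recovery (hΩ : IsOpen Ω) {ρ ν : ℝ} (hν : 0 ≤ ν) {y : H1 Ω E3 × L2 Ω DevT}
    (hy : y ∈ finiteStates A uDir ρ ν 0) :
    ∃ x : ℕ → H1 Ω E3 × L2 Ω DevT, TendstoState ν x atTop y ∧
      (∀ n, x n ∈ finiteStates A uDir ρ ν 0) ∧
      ∀ n, ∃ τ > 0, ∀ ν' h', 0 ≤ h' → h' ≤ τ → x n ∈ admissible A uDir ν' h' := by
  set r : ℕ → ℝ := fun n => 1 / ((n : ℝ) + 1) with hr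
  have hr0 : ∀ n, 0 < r n := fun n => Nat.one_div_pos_of_nat
  have hrlim : Tendsto r atTop (𝓝[>] 0) := tendsto_nhdsWithin_iff.2
    ⟨tendsto_one_div_add_atTop_nhds_zero_nat, Eventually.of_forall hr0⟩
  set x : ℕ → H1 Ω E3 × L2 Ω DevT := fun n =>
    (uDir + A.q (r n) (y.1 - uDir), A.r ν (r n) y.2) with hx
  have hrmem : ∀ n, A.r ν (r n) y.2 ∈ A.Z (r n) := fun n => A.r_mem ν (r n) hν (hr0 n) _ hy.1.1
  have hrH1 : ∀ n, IsH1 (A.r ν (r n) y.2) := fun n => A.isH1_of_mem_Z _ (hr0 n) _ (hrmem n)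
  have hadm : ∀ n, ∃ τ > 0, ∀ ν' h', 0 ≤ h' → h' ≤ τ → x n ∈ admissible A uDir ν' h' := by
    refine fun n => ⟨r n, hr0 n, fun ν' h' hh' hle => ⟨fun _ => hrH1 n, ?_, fun h0 => ?_⟩⟩
    · change VanishesOn Ω Γ (uDir + A.q (r n) (y.1 - uDir) - uDir)
      rw [add_sub_cancel_left]
      exact A.q_vanishesOn _ (hr0 n) _ hy.1.2.1
    · have hpos : 0 < h' := lt_of_le_of_ne hh' (Ne.symm h0)
      refine ⟨?_, A.mono_Z h' (r n) hpos hle (hrmem n)⟩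
      change uDir + A.q (r n) (y.1 - uDir) - uDir ∈ A.U h'
      rw [add_sub_cancel_left]
      exact A.mono_U h' (r n) hpos hle (A.q_mem _ (hr0 n) _)
  refine ⟨x, ?_, fun n => ⟨?_, fun h0 => A.r_bound ν (r n) hν (hr0 n) _ hy.1.1 (hy.2 h0)⟩, hadm⟩
  · refine tendstoState_of_stateNormSq hΩ hν (fun n _ => hrH1 n) hy.1.1 ?_
    have h1 : Tendsto (fun n => ‖A.q (r n) (y.1 - uDir) - (y.1 - uDir)‖ ^ 2) atTop (𝓝 0) := by
      have := (tendsto_sub_nhds_zero_iff.2 ((A.q_tendsto (y.1 - uDir)).comp hrlim)).norm.pow 2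
      rw [norm_zero, zero_pow two_ne_zero] at this
      exact this
    set g : ℕ → ℝ := fun n => ‖A.r ν (r n) y.2 - y.2‖ ^ 2
      + if ν = 0 then 0 else ‖gradL2 (A.r ν (r n) y.2 - y.2)‖ ^ 2 with hg
    have hg0 : ∀ n, 0 ≤ g n := fun n => by
      simp only [hg]; split_ifs <;> positivity
    have h2 : Tendsto g atTop (𝓝 0) := by
      have h3 := (A.r_tendsto ν hν y.2 hy.1.1).comp hrlim
      have h4 := (ENNReal.tendsto_toReal ENNReal.zero_ne_top).comp h3
      rw [ENNReal.toReal_zero] at h4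
      refine h4.congr fun n => ?_
      have h5 : MemSobolev ν (A.r ν (r n) y.2 - y.2) :=
        MemSobolev.sub (fun _ => hrH1 n) hy.1.1
      rw [Function.comp_apply, Function.comp_apply, sobolevNormSq_eq hΩ h5]
      exact ENNReal.toReal_ofReal (hg0 n)
    have h6 : Tendsto (fun n => ‖A.q (r n) (y.1 - uDir) - (y.1 - uDir)‖ ^ 2 + (1 + ν) * g n)
        atTop (𝓝 0) := by
      simpa using h1.add (h2.const_mul (1 + ν))
    refine squeeze_zero (fun n => stateNormSq_nonneg hν _) (fun n => ?_) h6
    have h7 := mul_grad_le ν hν (A.r ν (r n) y.2 - y.2)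
    have e1 : (x n - y).1 = A.q (r n) (y.1 - uDir) - (y.1 - uDir) := by
      change uDir + A.q (r n) (y.1 - uDir) - y.1 = _
      abel
    have e2 : (x n - y).2 = A.r ν (r n) y.2 - y.2 := rfl
    rw [stateNormSq, e1, e2]
    linarith
  · obtain ⟨τ, hτ, h1⟩ := hadm n
    exact h1 ν 0 le_rfl hτ.le

end Admissible

section Convergence

variable {Ω Γ : Set E3} [IsFiniteMeasure ((volume : Measure E3).restrict Ω)] {M : Material}
  {A : SpaceApprox Ω Γ M.c₃} {uDir : H1 Ω E3} {ℓ : H1 Ω E3 →L[ℝ] ℝ} {zbar : L2 Ω DevT}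
  {β B : ℝ} {ρs νs hs : ℕ → ℝ} {ρ ν h : ℝ}

/-- Lower bound for the minimal energies: they are eventually not much smaller than the minimal
energy for the limit parameters, since the admissible sets are contained in the limit one and the
energies decrease at most by the regularization in `ρ`. -/
theorem eventually_energy_ge (hΩ : IsOpen Ω) (hconv : EnergyConvex M A uDir ℓ zbar β)
    (hB : EnergyBound M A uDir ℓ zbar B) (hρ : ConstOrToZero ρs ρ) (hν : ConstOrToZero νs ν)
    (hh : ConstOrToZero hs h) {ys : ℕ → H1 Ω E3 × L2 Ω DevT} {y : H1 Ω E3 × L2 Ω DevT}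
    (hys : ∀ k, ys k ∈ finiteStates A uDir (ρs k) (νs k) (hs k))
    (hmin : ∀ w ∈ finiteStates A uDir ρ ν h, M.energy ℓ zbar ρ ν y ≤ M.energy ℓ zbar ρ ν w)
    {ε : ℝ} (hε : 0 < ε) :
    ∀ᶠ k in atTop, M.energy ℓ zbar ρ ν y - ε ≤ M.energy ℓ zbar (ρs k) (νs k) (ys k) := by
  have hadm : ∀ k, ys k ∈ admissible A uDir ν h := fun k => admissible_subset hν hh k (hys k).1
  have hgrad : ∀ k, M.energy ℓ zbar (ρs k) ν (ys k) ≤ M.energy ℓ zbar (ρs k) (νs k) (ys k) := by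
    intro k
    have : ν / 2 * ‖gradL2 (ys k).2‖ ^ 2 ≤ νs k / 2 * ‖gradL2 (ys k).2‖ ^ 2 :=
      mul_le_mul_of_nonneg_right (by linarith [hν.le k]) (sq_nonneg _)
    simp only [Material.energy]
    linarith
  rcases hρ.2.2 with hconst | ⟨rfl, hlim⟩
  · refine Eventually.of_forall fun k => ?_
    have h1 := hgrad k
    have h2 := hmin (ys k) ⟨hadm k, fun h0 => (hys k).2 (by rw [hconst k, h0])⟩
    rw [hconst k] at h1 ⊢
    linarith
  · obtain ⟨y₀, hy₀, hy₀'⟩ := exists_min_limit hΩ hconv hB hν.2.1 hh.2.1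
    obtain ⟨σ, hσ, h1⟩ := hy₀' ε hε
    filter_upwards [hlim.eventually_lt_const hσ] with k hk
    have h2 := h1 (ys k) (hadm k)
    have h3 := hmin y₀ hy₀
    have h4 : M.energy ℓ zbar σ ν (ys k) ≤ M.energy ℓ zbar (ρs k) ν (ys k) := by
      rcases (hρ.1 k).eq_or_lt with h0 | hpos
      · rw [← h0]
        exact M.energy_le_energy_zero ℓ zbar hσ.le le_rfl ((hys k).2 h0.symm)
      · exact M.energy_anti ℓ zbar hpos hk.le le_rfl _
    linarith [hgrad k]

/-- The energy of a fixed state is eventually not much larger than its energy for the limit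
parameters: the density at `ρ = 0` dominates the others where `|z| ≤ c₃`. -/
theorem eventually_energy_le (hρ : ConstOrToZero ρs ρ) (hν : ConstOrToZero νs ν)
    {y : H1 Ω E3 × L2 Ω DevT} (hy : y ∈ finiteStates A uDir ρ ν h) {ε : ℝ} (hε : 0 < ε) :
    ∀ᶠ k in atTop, M.energy ℓ zbar (ρs k) (νs k) y ≤ M.energy ℓ zbar ρ ν y + ε := by
  have h1 : ∀ k, M.energy ℓ zbar (ρs k) ν y ≤ M.energy ℓ zbar ρ ν y := by
    intro k
    rcases hρ.2.2 with hconst | ⟨rfl, _⟩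
    · rw [hconst k]
    · exact M.energy_le_energy_zero ℓ zbar (hρ.1 k) le_rfl (hy.2 rfl)
  have h2 : Tendsto (fun k => (νs k - ν) / 2 * ‖gradL2 y.2‖ ^ 2) atTop (𝓝 0) := by
    have := ((hν.tendsto.sub_const ν).div_const 2).mul_const (‖gradL2 y.2‖ ^ 2)
    simpa only [sub_self, zero_div, zero_mul] using this
  filter_upwards [h2.eventually_le_const hε] with k hk
  have h3 := h1 k
  simp only [Material.energy] at h3 ⊢
  linarith

/-- Every state of finite energy can be modified slightly so as to become admissible for all late
parameters. If `h = 0` the interpolation operators are used; the modified state does not depend on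
the parameters, and its second component has a square integrable gradient even if `ν = 0`. -/
theorem exists_competitor (hΩ : IsOpen Ω) (hρ : ConstOrToZero ρs ρ) (hν : ConstOrToZero νs ν)
    (hh : ConstOrToZero hs h) {y : H1 Ω E3 × L2 Ω DevT} (hy : y ∈ finiteStates A uDir ρ ν h)
    {ε : ℝ} (hε : 0 < ε) :
    ∃ w ∈ finiteStates A uDir ρ ν h, M.energy ℓ zbar ρ ν w ≤ M.energy ℓ zbar ρ ν y + ε ∧
      stateNormSq ν (w - y) < ε ∧
      ∀ᶠ k in atTop, w ∈ finiteStates A uDir (ρs k) (νs k) (hs k) := by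
  have hbd : ∀ w ∈ finiteStates A uDir ρ ν h, ∀ k, ρs k = 0 →
      ∀ᵐ x ∂((volume : Measure E3).restrict Ω), ‖w.2 x‖ ≤ M.c₃ := fun w hw k h0 =>
    hw.2 (le_antisymm ((hρ.le k).trans h0.le) hρ.2.1)
  by_cases h0 : h = 0
  · subst h0
    obtain ⟨x, hx, hxfin, hxadm⟩ := exists_recovery hΩ hν.2.1 hy
    have h1 := (M.tendsto_energy ℓ zbar hρ.2.1 hx).eventually_lt_const
      (lt_add_of_pos_right (M.energy ℓ zbar ρ ν y) hε)
    have h2 := (hx.stateNormSq hΩ (fun n => (hxfin n).1.1) hy.1.1).eventually_lt_const hε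
    obtain ⟨n, hn1, hn2⟩ := (h1.and h2).exists
    obtain ⟨τ, hτ, h3⟩ := hxadm n
    refine ⟨x n, hxfin n, hn1.le, hn2, ?_⟩
    filter_upwards [hh.tendsto.eventually_lt_const hτ] with k hk
    exact ⟨h3 _ _ (hh.1 k) hk.le, hbd _ (hxfin n) k⟩
  · refine ⟨y, hy, by linarith, ?_, Eventually.of_forall fun k => ⟨?_, hbd y hy k⟩⟩
    · have e := (show TendstoState ν (fun _ : ℕ => y) atTop y from
        ⟨tendsto_const_nhds, fun _ => tendsto_const_nhds⟩).stateNormSq hΩ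
          (fun _ => hy.1.1) hy.1.1
      rw [tendsto_const_nhds_iff.1 e]
      exact hε
    · have hpos : 0 < h := lt_of_le_of_ne hh.2.1 (Ne.symm h0)
      rw [hh.eq_of_ne_zero h0 k]
      exact ⟨fun _ => A.isH1_of_mem_Z h hpos _ (hy.1.2.2 h0).2, hy.1.2⟩

/-- The minimizers converge strongly. -/
theorem tendstoState_of_isMinimizer (hΩ : IsOpen Ω) (hconv : EnergyConvex M A uDir ℓ zbar β)
    (hB : EnergyBound M A uDir ℓ zbar B) (hρ : ConstOrToZero ρs ρ) (hν : ConstOrToZero νs ν)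
    (hh : ConstOrToZero hs h) {ys : ℕ → H1 Ω E3 × L2 Ω DevT} {y : H1 Ω E3 × L2 Ω DevT}
    (hys : ∀ k, IsMinimizer M A uDir ℓ zbar (ρs k) (νs k) (hs k) (ys k))
    (hy : IsMinimizer M A uDir ℓ zbar ρ ν h y) : TendstoState ν ys atTop y := by
  rw [isMinimizer_iff hΩ M A uDir ℓ zbar hρ.2.1 hν.2.1 h] at hy
  have hys' := fun k => (isMinimizer_iff hΩ M A uDir ℓ zbar (hρ.1 k) (hν.1 k) (hs k) (ys k)).1
    (hys k)
  have hadm : ∀ k, ys k ∈ admissible A uDir ν h := fun k =>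
    admissible_subset hν hh k (hys' k).1.1
  refine tendstoState_of_stateNormSq hΩ hν.2.1 (fun k => (hadm k).1) hy.1.1.1 ?_
  have hβ := hconv.1
  have key : ∀ ε > 0, ∀ᶠ k in atTop, stateNormSq ν (ys k - y) ≤ (3 / β + 2) * ε := by
    intro ε hε
    obtain ⟨w, hw, hwe, hwy, hwadm⟩ := exists_competitor (ℓ := ℓ) (zbar := zbar) hΩ hρ hν hh
      hy.1 hε
    filter_upwards [hwadm, eventually_energy_le (ℓ := ℓ) (zbar := zbar) hρ hν hw hε,
      eventually_energy_ge hΩ hconv hB hρ hν hh (fun k => (hys' k).1) hy.2 hε] with k h1 h2 h3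
    have h4 := stateNormSq_sub_le_of_min hconv (hρ.1 k) (hν.1 k) (hys' k).1 (hys' k).2 h1
    have h5 : stateNormSq ν (ys k - w) ≤ stateNormSq (νs k) (ys k - w) := by
      have := mul_le_mul_of_nonneg_right (hν.le k) (sq_nonneg ‖gradL2 (ys k - w).2‖)
      simp only [stateNormSq]
      linarith
    have h6 : stateNormSq ν (ys k - w) ≤ 3 / 2 * ε / β := by
      rw [le_div_iff₀' hβ]
      have := mul_le_mul_of_nonneg_left h5 hβ.le
      linarith
    have h7 := stateNormSq_add_le hΩ hν.2.1 (y := ys k - w) (w := w - y)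
      ((hadm k).1.sub hw.1.1) (hw.1.1.sub hy.1.1.1)
    rw [sub_add_sub_cancel] at h7
    have e : (3 / β + 2) * ε = 2 * (3 / 2 * ε / β + ε) := by field_simp
    rw [e]
    linarith
  rw [tendsto_order]
  refine ⟨fun a ha => Eventually.of_forall fun k => ha.trans_le (stateNormSq_nonneg hν.2.1 _),
    fun a ha => ?_⟩
  have hpos : 0 < 3 / β + 2 := by positivity
  filter_upwards [key (a / (2 * (3 / β + 2))) (by positivity)] with k hk
  have e : (3 / β + 2) * (a / (2 * (3 / β + 2))) = a / 2 := by field_simp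
  rw [e] at hk
  linarith

end Convergence

theorem weaklyTendsto_of_tendsto {X : Type*} [NormedAddCommGroup X] [NormedSpace ℝ X] {x : ℕ → X}
    {l : X} (h : Tendsto x atTop (𝓝 l)) : WeaklyTendsto x l :=
  ((toWeakSpaceCLM ℝ X).continuous.tendsto l).comp h

theorem weaklyTendstoSobolev_of_tendsto {Ω : Set E3} {V : Type*} [NormedAddCommGroup V]
    [NormedSpace ℝ V] [CompleteSpace V] (hΩ : IsOpen Ω) {ν : ℝ} {z : ℕ → L2 Ω V} {l : L2 Ω V}
    (hz : ∀ n, MemSobolev ν (z n)) (hl : MemSobolev ν l) (h : Tendsto z atTop (𝓝 l))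
    (hg : ν ≠ 0 → Tendsto (fun n => gradL2 (z n)) atTop (𝓝 (gradL2 l))) :
    WeaklyTendstoSobolev ν z l := by
  by_cases h0 : ν = 0
  · exact Or.inl ⟨h0, weaklyTendsto_of_tendsto h⟩
  choose Z hZ using fun n => hz n h0
  obtain ⟨L, hL⟩ := hl h0
  refine Or.inr ⟨h0, Z, L, hZ, hL, weaklyTendsto_of_tendsto ?_⟩
  rw [← tendsto_sub_nhds_zero_iff]
  have h1 := ((tendsto_sub_nhds_zero_iff.2 h).norm.pow 2).add
    ((tendsto_sub_nhds_zero_iff.2 (hg h0)).norm.pow 2)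
  simp only [norm_zero, zero_pow two_ne_zero, add_zero] at h1
  refine tendsto_zero_of_norm_sq_le (fun n => ?_) h1
  rw [norm_sq_H1, toL2_sub, weakGrad_sub, hZ, hL, ← gradL2_toL2 hΩ, ← gradL2_toL2 hΩ, hZ, hL]

end

end ShapeMemory

theorem mainTheorem6 (Ω Γ : Set E3)
    (hΩ_open : IsOpen Ω) (hΩ_conn : IsConnected Ω) (hΩ_bdd : Bornology.IsBounded Ω)
    (hΩ_lip : HasLipschitzBoundary Ω)
    (hΓ : ∃ O : Set E3, IsOpen O ∧ Γ = O ∩ frontier Ω)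
    (hKorn : KornInequality Ω Γ)
    (M : Material) (A : SpaceApprox Ω Γ M.c₃)
    (uDir : H1 Ω E3) (ℓ : H1 Ω E3 →L[ℝ] ℝ) (zbar : L2 Ω DevT) :
    (∀ ρ ν h : ℝ, 0 ≤ ρ → 0 ≤ ν → 0 ≤ h →
      ∃! y : H1 Ω E3 × L2 Ω DevT, IsMinimizer M A uDir ℓ zbar ρ ν h y) ∧
    (∀ (ρs νs hs : ℕ → ℝ) (ρ ν h : ℝ),
      ConstOrToZero ρs ρ → ConstOrToZero νs ν → ConstOrToZero hs h →
      ∀ (ys : ℕ → H1 Ω E3 × L2 Ω DevT) (y : H1 Ω E3 × L2 Ω DevT),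
        (∀ k, IsMinimizer M A uDir ℓ zbar (ρs k) (νs k) (hs k) (ys k)) →
        IsMinimizer M A uDir ℓ zbar ρ ν h y →
        WeaklyTendstoState ν ys y) := by
  have : IsFiniteMeasure ((volume : Measure E3).restrict Ω) :=
    isFiniteMeasure_restrict.2 hΩ_bdd.measure_lt_top.ne
  obtain ⟨β, hconv⟩ := exists_energyConvex (M := M) hΩ_open hKorn A uDir ℓ zbar
  obtain ⟨B, hB⟩ := exists_energyBound (M := M) hKorn A uDir ℓ zbar
  refine ⟨fun ρ ν h hρ hν hh => existsUnique_isMinimizer hΩ_open hconv hB hρ hν hh,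
    fun ρs νs hs ρ ν h hρ hν hh ys y hys hy => ?_⟩
  have hlim := tendstoState_of_isMinimizer hΩ_open hconv hB hρ hν hh hys hy
  exact ⟨weaklyTendsto_of_tendsto ((continuous_fst.tendsto y).comp hlim.1),
    weaklyTendstoSobolev_of_tendsto hΩ_open
      (fun k => (admissible_subset hν hh k (hys k).1).1) hy.1.1
      ((continuous_snd.tendsto y).comp hlim.1) hlim.2⟩
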